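/- Let $(M,g)$ be a compact smooth Riemannian $4$-manifold (without boundary) which is Ricci-flat, i.e. whose Ricci tensor vanishes identically. For $p\in M$ let $K_{\max}(p)$ (respectively $K_{\min}(p)$) denote the maximum (respectively the minimum) of the sectional curvatures of the $2$-dimensional subspaces of $T_pM$. Suppose that there is a constant $c$ with $0\le c<\frac{2+\sqrt6}{4}$ such that $$K_{\max}(p)\ \le\ -c\,K_{\min}(p)\qquad\text{for all } p\in M .$$ Then $(M,g)$ is flat, i.e. its Riemann curvature tensor vanishes identically. -/

import Mathlib

open scoped Manifold ContDiff

noncomputable section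

/-! ### Christoffel symbols and curvature of a metric on a vector space

`G : E → E →L[ℝ] E →L[ℝ] ℝ` is a metric on (an open part of) the model space `E`. The bilinear form
`G y` is also read as the linear map `E → E*`, `u ↦ G y u ·`, so that `(G y).inverse : E* → E`
raises an index. -/

namespace LocalMetric

variable {E : Type*} [NormedAddCommGroup E] [NormedSpace ℝ E] [FiniteDimensional ℝ E]

/-- The Christoffel symbols of `G` at `y` as a bilinear map: `Γ(u, v)` is the vector with
`2 G(Γ(u, v), w) = (∂_u G)(v, w) + (∂_v G)(u, w) - (∂_w G)(u, v)` for all `w`. -/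
def christoffel (G : E → E →L[ℝ] E →L[ℝ] ℝ) (y : E) : E →L[ℝ] E →L[ℝ] E :=
  LinearMap.toContinuousBilinearMap <| LinearMap.mk₂ ℝ
    (fun u v => (1 / 2 : ℝ) • (G y).inverse
      (fderiv ℝ G y u v + fderiv ℝ G y v u - ((fderiv ℝ G y).flip u).flip v))
    (fun u u' v => by
      rw [← smul_add, ← map_add]; congr 2; ext w; simp; ring)
    (fun c u v => by
      rw [smul_comm c, ← map_smul]; simp [smul_sub, smul_add])
    (fun u v v' => by
      rw [← smul_add, ← map_add]; congr 2; ext w; simp; ring)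
    (fun c u v => by
      rw [smul_comm c, ← map_smul]; simp [smul_sub, smul_add])

/-- The curvature of `G` at `y`, as the linear map `u ↦ R(u, v) w`, where
`R(u, v) w = (∂_u Γ)(v, w) - (∂_v Γ)(u, w) + Γ(u, Γ(v, w)) - Γ(v, Γ(u, w))`, that is
`R(u, v) w = ∇_u ∇_v w - ∇_v ∇_u w` for constant vector fields `u`, `v`, `w` on `E`. -/
def curvature (G : E → E →L[ℝ] E →L[ℝ] ℝ) (y v w : E) : E →ₗ[ℝ] E where
  toFun u :=
    fderiv ℝ (christoffel G) y u v w - fderiv ℝ (christoffel G) y v u w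
      + christoffel G y u (christoffel G y v w) - christoffel G y v (christoffel G y u w)
  map_add' u u' := by simp; abel
  map_smul' c u := by simp [smul_sub, smul_add]

end LocalMetric

/-! ### Curvature of a Riemannian manifold -/

namespace Riemannian

variable {E : Type*} [NormedAddCommGroup E] [NormedSpace ℝ E]
  {M : Type*} [TopologicalSpace M] [ChartedSpace E M] [IsManifold 𝓘(ℝ, E) ∞ M]

variable (E M) in
/-- Smooth Riemannian metrics on the smooth manifold `M` without boundary, modelled on `E`. -/
abbrev Metric : Type _ :=
  Bundle.ContMDiffRiemannianMetric 𝓘(ℝ, E) ∞ E (fun x : M => TangentSpace 𝓘(ℝ, E) x)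

/-- The metric `g` in the chart `φ` around `x₀`, i.e. the pullback `(φ⁻¹)^* g`, a metric on the open
subset `φ.target` of `E`. -/
def metricInChart (g : Metric E M) (x₀ : M) (y : E) : E →L[ℝ] E →L[ℝ] ℝ :=
  let φ := extChartAt 𝓘(ℝ, E) x₀
  let A : E →L[ℝ] TangentSpace 𝓘(ℝ, E) (φ.symm y) := mfderiv 𝓘(ℝ, E) 𝓘(ℝ, E) φ.symm y
  (ContinuousLinearMap.precomp ℝ A).comp ((g.inner (φ.symm y)).comp A)

variable [FiniteDimensional ℝ E]

/-- The Riemann curvature tensor of `g` at `p`, as the linear map `u ↦ R(u, v) w` on `T_p M`,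
computed in the chart `φ` around `p`. -/
def curvature (g : Metric E M) (p : M) (v w : TangentSpace 𝓘(ℝ, E) p) :
    TangentSpace 𝓘(ℝ, E) p →ₗ[ℝ] TangentSpace 𝓘(ℝ, E) p :=
  let φ := extChartAt 𝓘(ℝ, E) p
  let D : TangentSpace 𝓘(ℝ, E) p →L[ℝ] E := mfderiv 𝓘(ℝ, E) 𝓘(ℝ, E) φ p
  D.inverse.toLinearMap ∘ₗ LocalMetric.curvature (metricInChart g p) (φ p) (D v) (D w)
    ∘ₗ D.toLinearMap

/-- The Ricci tensor `Ric(v, w) = tr (u ↦ R(u, v) w)`. -/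
def ricci (g : Metric E M) (p : M) (v w : TangentSpace 𝓘(ℝ, E) p) : ℝ :=
  LinearMap.trace ℝ (TangentSpace 𝓘(ℝ, E) p) (curvature g p v w)

/-- The sectional curvature of the plane spanned by linearly independent `u`, `v`. -/
def sectionalCurvature (g : Metric E M) (p : M) (u v : TangentSpace 𝓘(ℝ, E) p) : ℝ :=
  g.inner p (curvature g p v v u) u /
    (g.inner p u u * g.inner p v v - g.inner p u v ^ 2)

/-- The set of the sectional curvatures of all planes in `T_p M`. In dimension at least two it is
nonempty and compact. -/
def sectionalCurvatures (g : Metric E M) (p : M) : Set ℝ :=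
  {k | ∃ u v : TangentSpace 𝓘(ℝ, E) p,
    LinearIndependent ℝ ![u, v] ∧ sectionalCurvature g p u v = k}

/-- The maximum of the sectional curvatures at `p`. -/
def Kmax (g : Metric E M) (p : M) : ℝ := sSup (sectionalCurvatures g p)

/-- The minimum of the sectional curvatures at `p`. -/
def Kmin (g : Metric E M) (p : M) : ℝ := sInf (sectionalCurvatures g p)

/-- The metric `g` is Ricci-flat: its Ricci tensor vanishes. -/
def IsRicciFlat (g : Metric E M) : Prop :=
  ∀ (p : M) (v w : TangentSpace 𝓘(ℝ, E) p), ricci g p v w = 0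

/-- The metric `g` is flat: its Riemann curvature tensor vanishes. -/
def IsFlat (g : Metric E M) : Prop :=
  ∀ (p : M) (u v w : TangentSpace 𝓘(ℝ, E) p), curvature g p v w u = 0

end Riemannian

end

/-!
At a plane where the sectional curvature attains its minimum `k` over `M`, take an orthonormal
frame `e₀, …, e₃` with `e₀, e₁` spanning the plane, and extend the curvature `T(e₀, e₁, e₁, e₀)`
to nearby points by the constant frame of normal coordinates. Its Laplacian is controlled from
below by minimality, while the second Bianchi identity, Ricci-flatness and the Ricci identity turn
it into a quadratic expression in `T`. For a `T` without Ricci contraction the outcome reads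
`3 (k² + μ²) ≤ 4 (sum of four squares of components)` with `μ = T₀₁₂₃`. Let `κ` be the maximum of
the sectional curvatures at that point. Cauchy–Schwarz for the nonnegative forms
`κ |u ∧ w|² - R(u, w, w, u)` with `w = e₂` and `w = e₂ + e₃` confines the squares to two disks of
radius `κ + k / 2`. Hence `3 k² ≤ 8 (κ + k / 2)²`, that is, `κ ≥ (2 + √6) / 4 · (-k)`. The
pinching then forces `0 ≤ k`, and nonnegative sectional curvature with zero Ricci tensor vanishes.
-/

set_option maxSynthPendingDepth 3

section SecondDerivative

variable {E F F' : Type*} [NormedAddCommGroup E] [NormedSpace ℝ E]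
  [NormedAddCommGroup F] [NormedSpace ℝ F] [NormedAddCommGroup F'] [NormedSpace ℝ F'] {y : E}

theorem fderiv_clm_apply_const {A : E → F →L[ℝ] F'} (hA : DifferentiableAt ℝ A y) (v : F) (u : E) :
    fderiv ℝ (fun x => A x v) y u = fderiv ℝ A y u v := by
  simp [fderiv_clm_apply hA (differentiableAt_const v)]

theorem fderiv_clm_apply₂_const {F'' : Type*} [NormedAddCommGroup F''] [NormedSpace ℝ F'']
    {A : E → F →L[ℝ] F' →L[ℝ] F''} (hA : DifferentiableAt ℝ A y) (v : F) (w : F') (u : E) :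
    fderiv ℝ (fun x => A x v w) y u = fderiv ℝ A y u v w := by
  rw [fderiv_clm_apply_const (by fun_prop), fderiv_clm_apply_const hA]

theorem fderiv_apply_comm_of_eventually {A : E → F →L[ℝ] F →L[ℝ] F'}
    (hA : DifferentiableAt ℝ A y) {v w : F} (h : ∀ᶠ x in nhds y, A x v w = A x w v) (u : E) :
    fderiv ℝ A y u v w = fderiv ℝ A y u w v := by
  have h' : (fun x => A x v w) =ᶠ[nhds y] fun x => A x w v := h
  rw [← fderiv_clm_apply₂_const hA, ← fderiv_clm_apply₂_const hA, h'.fderiv_eq]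

theorem differentiableAt_fderiv {f : E → F} (hf : ContDiffAt ℝ 2 f y) :
    DifferentiableAt ℝ (fderiv ℝ f) y :=
  (hf.fderiv_right (m := 1) (by norm_num)).differentiableAt one_ne_zero

theorem eventually_differentiableAt {f : E → F} (hf : ContDiffAt ℝ 2 f y) :
    ∀ᶠ x in nhds y, DifferentiableAt ℝ f x := by
  filter_upwards [hf.eventually (by simp)] with x hx using hx.differentiableAt two_ne_zero

theorem fderiv_fderiv_comm {f : E → F} (hf : ContDiffAt ℝ 2 f y) (m n : E) :
    fderiv ℝ (fderiv ℝ f) y m n = fderiv ℝ (fderiv ℝ f) y n m :=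
  hf.isSymmSndFDerivAt (by simp) m n

theorem fderiv_fderiv_clm_apply {f : E → F →L[ℝ] F'} {g : E → F}
    (hf : ContDiffAt ℝ 2 f y) (hg : ContDiffAt ℝ 2 g y) (m n : E) :
    fderiv ℝ (fderiv ℝ fun x => f x (g x)) y m n =
      f y (fderiv ℝ (fderiv ℝ g) y m n) + fderiv ℝ f y m (fderiv ℝ g y n)
      + fderiv ℝ f y n (fderiv ℝ g y m) + fderiv ℝ (fderiv ℝ f) y m n (g y) := by
  have first : (fun x => fderiv ℝ (fun x => f x (g x)) x n) =ᶠ[nhds y]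
      fun x => f x (fderiv ℝ g x n) + fderiv ℝ f x n (g x) := by
    filter_upwards [eventually_differentiableAt hf, eventually_differentiableAt hg] with x hfx hgx
    simp [fderiv_clm_apply hfx hgx]
  have hn : HasFDerivAt (fun _ : E => n) (0 : E →L[ℝ] E) y := hasFDerivAt_const n y
  have df := (hf.differentiableAt two_ne_zero).hasFDerivAt
  have dg := (hg.differentiableAt two_ne_zero).hasFDerivAt
  have second := (df.clm_apply ((differentiableAt_fderiv hg).hasFDerivAt.clm_apply hn)).fun_add
    (((differentiableAt_fderiv hf).hasFDerivAt.clm_apply hn).clm_apply dg)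
  rw [← fderiv_clm_apply_const (differentiableAt_fderiv (hf.clm_apply hg)), first.fderiv_eq,
    second.fderiv]
  simp
  abel

theorem fderiv_fderiv_clm_apply_const {f : E → F →L[ℝ] F'} (hf : ContDiffAt ℝ 2 f y) (v : F)
    (m n : E) :
    fderiv ℝ (fderiv ℝ fun x => f x v) y m n = fderiv ℝ (fderiv ℝ f) y m n v := by
  simp [fderiv_fderiv_clm_apply hf contDiffAt_const]

theorem fderiv_fderiv_clm_apply₂_const {F'' : Type*} [NormedAddCommGroup F''] [NormedSpace ℝ F'']
    {f : E → F →L[ℝ] F' →L[ℝ] F''} (hf : ContDiffAt ℝ 2 f y) (v : F) (w : F') (m n : E) :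
    fderiv ℝ (fderiv ℝ fun x => f x v w) y m n = fderiv ℝ (fderiv ℝ f) y m n v w := by
  rw [fderiv_fderiv_clm_apply_const (hf.clm_apply contDiffAt_const),
    fderiv_fderiv_clm_apply_const hf]

theorem fderiv_fderiv_const_clm_apply (L : F →L[ℝ] F') {f : E → F} (hf : ContDiffAt ℝ 2 f y)
    (m n : E) :
    fderiv ℝ (fderiv ℝ fun x => L (f x)) y m n = L (fderiv ℝ (fderiv ℝ f) y m n) := by
  simp [fderiv_fderiv_clm_apply contDiffAt_const hf]

theorem fderiv_fderiv_add {f g : E → F} (hf : ContDiffAt ℝ 2 f y) (hg : ContDiffAt ℝ 2 g y)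
    (m n : E) :
    fderiv ℝ (fderiv ℝ fun x => f x + g x) y m n =
      fderiv ℝ (fderiv ℝ f) y m n + fderiv ℝ (fderiv ℝ g) y m n := by
  have first : fderiv ℝ (fun x => f x + g x) =ᶠ[nhds y] fun x => fderiv ℝ f x + fderiv ℝ g x := by
    filter_upwards [eventually_differentiableAt hf, eventually_differentiableAt hg] with x hfx hgx
      using fderiv_fun_add hfx hgx
  rw [first.fderiv_eq, fderiv_fun_add (differentiableAt_fderiv hf) (differentiableAt_fderiv hg)]
  rfl

theorem fderiv_fderiv_const_smul {f : E → F} (hf : ContDiffAt ℝ 2 f y) (c : ℝ) (m n : E) :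
    fderiv ℝ (fderiv ℝ fun x => c • f x) y m n = c • fderiv ℝ (fderiv ℝ f) y m n :=
  fderiv_fderiv_const_clm_apply (c • ContinuousLinearMap.id ℝ F) hf m n

theorem fderiv_fderiv_sub {f g : E → F} (hf : ContDiffAt ℝ 2 f y) (hg : ContDiffAt ℝ 2 g y)
    (m n : E) :
    fderiv ℝ (fderiv ℝ fun x => f x - g x) y m n =
      fderiv ℝ (fderiv ℝ f) y m n - fderiv ℝ (fderiv ℝ g) y m n := by
  have add_neg := fderiv_fderiv_add hf (hg.const_smul (-1 : ℝ)) m n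
  rw [fderiv_fderiv_const_smul hg] at add_neg
  simpa [sub_eq_add_neg] using add_neg

theorem fderiv_fderiv_sum {ι : Type*} {f : ι → E → F} (hf : ∀ i, ContDiffAt ℝ 2 (f i) y)
    (s : Finset ι) (m n : E) :
    fderiv ℝ (fderiv ℝ fun x => ∑ i ∈ s, f i x) y m n =
      ∑ i ∈ s, fderiv ℝ (fderiv ℝ (f i)) y m n := by
  classical
  induction s using Finset.induction_on with
  | empty => simp
  | insert a s ha ih =>
    simp only [Finset.sum_insert ha]
    rw [fderiv_fderiv_add (hf a) (ContDiffAt.sum fun i _ => hf i), ih]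

theorem fderiv_fderiv_mul_of_fderiv_eq_zero {a b : E → ℝ} (ha : ContDiffAt ℝ 2 a y)
    (hb : ContDiffAt ℝ 2 b y) (hb' : fderiv ℝ b y = 0) (m n : E) :
    fderiv ℝ (fderiv ℝ fun x => a x * b x) y m n =
      a y * fderiv ℝ (fderiv ℝ b) y m n + fderiv ℝ (fderiv ℝ a) y m n * b y := by
  simpa [hb', fderiv_fderiv_const_clm_apply _ ha] using
    fderiv_fderiv_clm_apply (f := fun x => ContinuousLinearMap.mul ℝ ℝ (a x))
      (contDiffAt_const.clm_apply ha) hb m n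

end SecondDerivative

section LocalMin

theorem deriv_deriv_nonneg_of_isLocalMin {f : ℝ → ℝ} {t : ℝ} (hf : ContinuousAt f t)
    (hmin : IsLocalMin f t) : 0 ≤ deriv (deriv f) t := by
  by_contra! hneg
  have hmax := isLocalMax_of_deriv_deriv_neg hneg hmin.deriv_eq_zero hf
  have hconst : f =ᶠ[nhds t] fun _ => f t := by
    filter_upwards [hmin, hmax] with s hs hs' using le_antisymm hs' hs
  simp [hconst.deriv.deriv_eq] at hneg

variable {E : Type*} [NormedAddCommGroup E] [NormedSpace ℝ E] {f : E → ℝ} {y : E}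

theorem deriv_deriv_comp_line (hf : ContDiffAt ℝ 2 f y) (m : E) :
    deriv (deriv fun t : ℝ => f (y + t • m)) 0 = fderiv ℝ (fderiv ℝ f) y m m := by
  have hline (t : ℝ) : HasDerivAt (fun t : ℝ => y + t • m) m t := by
    simpa using ((hasDerivAt_id t).smul_const m).const_add y
  have hline0 : y + (0 : ℝ) • m = y := by simp
  have hlim : Filter.Tendsto (fun t : ℝ => y + t • m) (nhds 0) (nhds y) := by
    simpa using (hline 0).continuousAt.tendsto
  have first : deriv (fun t : ℝ => f (y + t • m)) =ᶠ[nhds 0] fun t => fderiv ℝ f (y + t • m) m := by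
    filter_upwards [hlim.eventually (eventually_differentiableAt hf)] with t ht
      using (ht.hasFDerivAt.comp_hasDerivAt t (hline t)).deriv
  have hf' : HasFDerivAt (fun x => fderiv ℝ f x m) ((fderiv ℝ (fderiv ℝ f) y).flip m) y := by
    simpa using (differentiableAt_fderiv hf).hasFDerivAt.clm_apply (hasFDerivAt_const m y)
  have second := hf'.comp_hasDerivAt_of_eq (0 : ℝ) (hline 0) hline0.symm
  exact first.deriv_eq.trans second.deriv

theorem fderiv_fderiv_nonneg_of_isLocalMin (hf : ContDiffAt ℝ 2 f y) (hmin : IsLocalMin f y)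
    (m : E) : 0 ≤ fderiv ℝ (fderiv ℝ f) y m m := by
  have hline0 : y + (0 : ℝ) • m = y := by simp
  have hline : Filter.Tendsto (fun t : ℝ => y + t • m) (nhds 0) (nhds y) := by
    have : ContinuousAt (fun t : ℝ => y + t • m) 0 := by fun_prop
    simpa only [ContinuousAt, hline0] using this
  have hmin' : IsLocalMin (fun t : ℝ => f (y + t • m)) 0 := by
    simpa only [IsLocalMin, IsMinFilter, hline0] using hline.eventually hmin
  rw [← deriv_deriv_comp_line hf m]
  exact deriv_deriv_nonneg_of_isLocalMin
    (hf.continuousAt.comp_of_eq (by fun_prop) hline0) hmin'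

end LocalMin

namespace LocalMetric

section Basic

variable {E : Type*} [NormedAddCommGroup E] [NormedSpace ℝ E]

/-- `G` restricts to a smooth Riemannian metric on the open subset `U` of the model space. -/
structure IsMetricOn (G : E → E →L[ℝ] E →L[ℝ] ℝ) (U : Set E) : Prop where
  isOpen : IsOpen U
  contDiffOn : ContDiffOn ℝ ∞ G U
  symm : ∀ y ∈ U, ∀ u v, G y u v = G y v u
  pos : ∀ y ∈ U, ∀ u, u ≠ 0 → 0 < G y u u

namespace IsMetricOn

variable {G : E → E →L[ℝ] E →L[ℝ] ℝ} {U : Set E} {y : E}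

theorem mem_nhds (hG : IsMetricOn G U) (hy : y ∈ U) : U ∈ nhds y :=
  hG.isOpen.mem_nhds hy

theorem contDiffAt (hG : IsMetricOn G U) (hy : y ∈ U) : ContDiffAt ℝ ∞ G y :=
  hG.contDiffOn.contDiffAt (hG.mem_nhds hy)

theorem differentiableAt (hG : IsMetricOn G U) (hy : y ∈ U) : DifferentiableAt ℝ G y :=
  (hG.contDiffAt hy).differentiableAt (by simp)

theorem fderiv_symm (hG : IsMetricOn G U) (hy : y ∈ U) (u v w : E) :
    fderiv ℝ G y u v w = fderiv ℝ G y u w v :=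
  fderiv_apply_comm_of_eventually (hG.differentiableAt hy)
    (Filter.eventually_of_mem (hG.mem_nhds hy) fun x hx => hG.symm x hx v w) u

theorem ext_of_apply (hG : IsMetricOn G U) (hy : y ∈ U) {a b : E}
    (h : ∀ w, G y a w = G y b w) : a = b := by
  by_contra hab
  have hpos := hG.pos y hy (a - b) (sub_ne_zero.2 hab)
  rw [(G y).map_sub, sub_apply, h (a - b), sub_self] at hpos
  exact lt_irrefl _ hpos

variable [FiniteDimensional ℝ E]

theorem isInvertible (hG : IsMetricOn G U) (hy : y ∈ U) : (G y).IsInvertible := by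
  have hinj : Function.Injective (G y).toLinearMap := fun a b h =>
    hG.ext_of_apply hy fun w => DFunLike.congr_fun (h : G y a = G y b) w
  have hdim : Module.finrank ℝ E = Module.finrank ℝ (E →L[ℝ] ℝ) :=
    Subspace.dual_finrank_eq.symm.trans
      (LinearMap.toContinuousLinearMap (𝕜 := ℝ) (E := E) (F' := ℝ)).finrank_eq
  exact ⟨(LinearEquiv.ofInjectiveOfFinrankEq _ hinj hdim).toContinuousLinearEquiv, rfl⟩

theorem apply_christoffel (hG : IsMetricOn G U) (hy : y ∈ U) (u v w : E) :
    G y (christoffel G y u v) w =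
      (1 / 2 : ℝ) * (fderiv ℝ G y u v w + fderiv ℝ G y v u w - fderiv ℝ G y w u v) := by
  simp only [christoffel, LinearMap.toContinuousBilinearMap_apply, LinearMap.mk₂_apply, map_smul]
  rw [(hG.isInvertible hy).self_apply_inverse]
  simp

theorem christoffel_symm (hG : IsMetricOn G U) (hy : y ∈ U) (u v : E) :
    christoffel G y u v = christoffel G y v u := by
  refine hG.ext_of_apply hy fun w => ?_
  rw [hG.apply_christoffel hy, hG.apply_christoffel hy, hG.fderiv_symm hy w u v]
  ring

theorem fderiv_eq (hG : IsMetricOn G U) (hy : y ∈ U) (u v w : E) :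
    fderiv ℝ G y u v w = G y (christoffel G y u v) w + G y v (christoffel G y u w) := by
  rw [hG.symm y hy v, hG.apply_christoffel hy, hG.apply_christoffel hy,
    hG.fderiv_symm hy v u w, hG.fderiv_symm hy w u v, hG.fderiv_symm hy u w v]
  ring

theorem contDiffOn_inverse (hG : IsMetricOn G U) :
    ContDiffOn ℝ ∞ (fun y => (G y).inverse) U := by
  intro y hy
  obtain ⟨e, he⟩ := hG.isInvertible hy
  have hinverse := contDiffAt_map_inverse (n := ∞) e
  rw [he] at hinverse
  exact (hinverse.comp y (hG.contDiffAt hy)).contDiffWithinAt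

theorem contDiffOn_christoffel (hG : IsMetricOn G U) : ContDiffOn ℝ ∞ (christoffel G) U := by
  have hderiv (u v : E) : ContDiffOn ℝ ∞ (fun y => fderiv ℝ G y u v) U :=
    ((hG.contDiffOn.fderiv_of_isOpen hG.isOpen (by simp)).clm_apply contDiffOn_const).clm_apply
      contDiffOn_const
  have hflip (u v : E) : ContDiffOn ℝ ∞ (fun y => ((fderiv ℝ G y).flip u).flip v) U :=
    contDiffOn_clm_apply.2 fun w => (hderiv w u).clm_apply (contDiffOn_const (c := v))
  refine contDiffOn_clm_apply.2 fun u => contDiffOn_clm_apply.2 fun v => ?_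
  exact contDiffOn_const.smul
    (hG.contDiffOn_inverse.clm_apply (((hderiv u v).add (hderiv v u)).sub (hflip u v)))

theorem contDiffAt_christoffel (hG : IsMetricOn G U) (hy : y ∈ U) :
    ContDiffAt ℝ ∞ (christoffel G) y :=
  hG.contDiffOn_christoffel.contDiffAt (hG.mem_nhds hy)

theorem differentiableAt_christoffel (hG : IsMetricOn G U) (hy : y ∈ U) :
    DifferentiableAt ℝ (christoffel G) y :=
  (hG.contDiffAt_christoffel hy).differentiableAt (by simp)

theorem fderiv_christoffel_symm (hG : IsMetricOn G U) (hy : y ∈ U) (u v w : E) :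
    fderiv ℝ (christoffel G) y u v w = fderiv ℝ (christoffel G) y u w v :=
  fderiv_apply_comm_of_eventually (hG.differentiableAt_christoffel hy)
    (Filter.eventually_of_mem (hG.mem_nhds hy) fun _ hx => hG.christoffel_symm hx v w) u

theorem fderiv_fderiv_apply (hG : IsMetricOn G U) (hy : y ∈ U) (u v w z : E) :
    fderiv ℝ (fderiv ℝ G) y u v w z =
      G y (fderiv ℝ (christoffel G) y u v w) z + G y w (fderiv ℝ (christoffel G) y u v z)
      + G y (christoffel G y u (christoffel G y v w)) z
      + G y (christoffel G y v w) (christoffel G y u z)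
      + G y (christoffel G y u w) (christoffel G y v z)
      + G y w (christoffel G y u (christoffel G y v z)) := by
  have hderiv := differentiableAt_fderiv ((hG.contDiffAt hy).of_le (by norm_cast))
  have hΓ := hG.differentiableAt_christoffel hy
  have hd := (hG.differentiableAt hy).hasFDerivAt
  have compat : (fun x => fderiv ℝ G x v w z) =ᶠ[nhds y] fun x =>
      G x (christoffel G x v w) z + G x w (christoffel G x v z) :=
    Filter.eventually_of_mem (hG.mem_nhds hy) fun x hx => hG.fderiv_eq hx v w z
  have hc (w : E) : HasFDerivAt (fun x => christoffel G x v w)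
      (fderiv ℝ (fun x => christoffel G x v w) y) y :=
    DifferentiableAt.hasFDerivAt (by fun_prop)
  have hleft := (hd.clm_apply (hc w)).clm_apply (hasFDerivAt_const z y)
  have hright := (hd.clm_apply (hasFDerivAt_const w y)).clm_apply (hc z)
  have outer : fderiv ℝ (fderiv ℝ G) y u v w z = fderiv ℝ (fun x => fderiv ℝ G x v w z) y u := by
    rw [fderiv_clm_apply₂_const (hderiv.clm_apply (differentiableAt_const v)),
      fderiv_clm_apply_const hderiv]
  rw [outer, compat.fderiv_eq, (hleft.fun_add hright).fderiv]
  simp only [fderiv_clm_apply₂_const hΓ, hG.fderiv_eq hy, add_apply,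
    ContinuousLinearMap.comp_apply, ContinuousLinearMap.flip_apply, zero_apply, map_zero, zero_add]
  ring

end IsMetricOn

end Basic

section CurvatureTensor

variable {E : Type*} [NormedAddCommGroup E] [NormedSpace ℝ E] [FiniteDimensional ℝ E]
  {G : E → E →L[ℝ] E →L[ℝ] ℝ} {U : Set E} {y : E}

theorem curvature_apply (u v w : E) : curvature G y v w u =
    fderiv ℝ (christoffel G) y u v w - fderiv ℝ (christoffel G) y v u w
      + christoffel G y u (christoffel G y v w) - christoffel G y v (christoffel G y u w) := rfl

theorem curvature_antisymm (u v w : E) : curvature G y v w u = -curvature G y u w v := by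
  simp only [curvature_apply]
  abel

namespace IsMetricOn

theorem curvature_bianchi (hG : IsMetricOn G U) (hy : y ∈ U) (u v w : E) :
    curvature G y v w u + curvature G y w u v + curvature G y u v w = 0 := by
  simp only [curvature_apply]
  rw [hG.fderiv_christoffel_symm hy u w v, hG.fderiv_christoffel_symm hy v w u,
    hG.fderiv_christoffel_symm hy w v u, hG.christoffel_symm hy w v,
    hG.christoffel_symm hy u w, hG.christoffel_symm hy v u]
  abel

theorem curvature_skew (hG : IsMetricOn G U) (hy : y ∈ U) (u v w z : E) :
    G y (curvature G y v w u) z = -G y (curvature G y v z u) w := by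
  have second := fderiv_fderiv_comm ((hG.contDiffAt hy).of_le (by norm_cast)) u v
  have commuted := DFunLike.congr_fun (DFunLike.congr_fun second w) z
  rw [hG.fderiv_fderiv_apply hy, hG.fderiv_fderiv_apply hy] at commuted
  rw [hG.symm y hy _ w]
  simp only [curvature_apply, map_add, map_sub, add_apply, sub_apply]
  linear_combination commuted

end IsMetricOn

end CurvatureTensor

section Pullback

variable {E : Type*} [NormedAddCommGroup E] [NormedSpace ℝ E]

/-- On the open set `V`, the metric `G'` is the pullback of the metric `G` on `U` under the
immersion `ψ` of `V` into `U`. -/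
structure IsPullbackOn (G' G : E → E →L[ℝ] E →L[ℝ] ℝ) (ψ : E → E) (V U : Set E) : Prop where
  isMetricOn : IsMetricOn G U
  isOpen : IsOpen V
  contDiffOn : ContDiffOn ℝ ∞ ψ V
  mapsTo : Set.MapsTo ψ V U
  injective : ∀ x ∈ V, Function.Injective (fderiv ℝ ψ x)
  apply_eq : ∀ x ∈ V, ∀ u v, G' x u v = G (ψ x) (fderiv ℝ ψ x u) (fderiv ℝ ψ x v)

namespace IsPullbackOn

variable {G' G : E → E →L[ℝ] E →L[ℝ] ℝ} {ψ : E → E} {V U : Set E} {x : E}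

theorem mem_nhds (h : IsPullbackOn G' G ψ V U) (hx : x ∈ V) : V ∈ nhds x :=
  h.isOpen.mem_nhds hx

theorem contDiffAt (h : IsPullbackOn G' G ψ V U) (hx : x ∈ V) : ContDiffAt ℝ ∞ ψ x :=
  h.contDiffOn.contDiffAt (h.mem_nhds hx)

theorem contDiffOn_fderiv (h : IsPullbackOn G' G ψ V U) : ContDiffOn ℝ ∞ (fderiv ℝ ψ) V :=
  h.contDiffOn.fderiv_of_isOpen h.isOpen (by simp)

theorem contDiffAt_fderiv (h : IsPullbackOn G' G ψ V U) (hx : x ∈ V) :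
    ContDiffAt ℝ ∞ (fderiv ℝ ψ) x :=
  h.contDiffOn_fderiv.contDiffAt (h.mem_nhds hx)

theorem fderiv_fderiv_symm (h : IsPullbackOn G' G ψ V U) (hx : x ∈ V) (u v : E) :
    fderiv ℝ (fderiv ℝ ψ) x u v = fderiv ℝ (fderiv ℝ ψ) x v u :=
  fderiv_fderiv_comm ((h.contDiffAt hx).of_le (by norm_cast)) u v

theorem hasFDerivAt_comp (h : IsPullbackOn G' G ψ V U) (hx : x ∈ V) {F : Type*}
    [NormedAddCommGroup F] [NormedSpace ℝ F] {A : E → F} (hA : DifferentiableAt ℝ A (ψ x)) :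
    HasFDerivAt (fun y => A (ψ y)) ((fderiv ℝ A (ψ x)).comp (fderiv ℝ ψ x)) x :=
  hA.hasFDerivAt.comp x ((h.contDiffAt hx).differentiableAt (by simp)).hasFDerivAt

theorem hasFDerivAt_fderiv_apply (h : IsPullbackOn G' G ψ V U) (hx : x ∈ V) (v : E) :
    HasFDerivAt (fun y => fderiv ℝ ψ y v) ((fderiv ℝ (fderiv ℝ ψ) x).flip v) x := by
  simpa using ((h.contDiffAt_fderiv hx).differentiableAt (by simp)).hasFDerivAt.clm_apply
    (hasFDerivAt_const v x)

variable [FiniteDimensional ℝ E]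

theorem isMetricOn_pullback (h : IsPullbackOn G' G ψ V U) : IsMetricOn G' V where
  isOpen := h.isOpen
  contDiffOn := by
    refine contDiffOn_clm_apply.2 fun u => contDiffOn_clm_apply.2 fun v => ?_
    refine ContDiffOn.congr ?_ fun x hx => h.apply_eq x hx u v
    exact ((h.isMetricOn.contDiffOn.comp h.contDiffOn h.mapsTo).clm_apply
      (h.contDiffOn_fderiv.clm_apply contDiffOn_const)).clm_apply
      (h.contDiffOn_fderiv.clm_apply contDiffOn_const)
  symm x hx u v := by
    rw [h.apply_eq x hx, h.apply_eq x hx, h.isMetricOn.symm _ (h.mapsTo hx)]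
  pos x hx u hu := by
    rw [h.apply_eq x hx]
    exact h.isMetricOn.pos _ (h.mapsTo hx) _ ((map_ne_zero_iff _ (h.injective x hx)).2 hu)

theorem fderiv_apply (h : IsPullbackOn G' G ψ V U) (hx : x ∈ V) (u v w : E) :
    fderiv ℝ G' x u v w =
      fderiv ℝ G (ψ x) (fderiv ℝ ψ x u) (fderiv ℝ ψ x v) (fderiv ℝ ψ x w)
      + G (ψ x) (fderiv ℝ (fderiv ℝ ψ) x u v) (fderiv ℝ ψ x w)
      + G (ψ x) (fderiv ℝ ψ x v) (fderiv ℝ (fderiv ℝ ψ) x u w) := by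
  have pullback : (fun x => G' x v w) =ᶠ[nhds x]
      fun x => G (ψ x) (fderiv ℝ ψ x v) (fderiv ℝ ψ x w) :=
    Filter.eventually_of_mem (h.mem_nhds hx) fun y hy => h.apply_eq y hy v w
  have hd := ((h.hasFDerivAt_comp hx (h.isMetricOn.differentiableAt (h.mapsTo hx))).clm_apply
    (h.hasFDerivAt_fderiv_apply hx v)).clm_apply (h.hasFDerivAt_fderiv_apply hx w)
  rw [← fderiv_clm_apply₂_const (h.isMetricOn_pullback.differentiableAt hx),
    pullback.fderiv_eq, hd.fderiv]
  simp only [add_apply, ContinuousLinearMap.comp_apply, ContinuousLinearMap.flip_apply]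
  ring

theorem fderiv_christoffel_apply (h : IsPullbackOn G' G ψ V U) (hx : x ∈ V) (u v : E) :
    fderiv ℝ ψ x (christoffel G' x u v) = fderiv ℝ (fderiv ℝ ψ) x u v
      + christoffel G (ψ x) (fderiv ℝ ψ x u) (fderiv ℝ ψ x v) := by
  have hψ := h.mapsTo hx
  have hG := h.isMetricOn
  refine hG.ext_of_apply hψ fun w => ?_
  obtain ⟨w, rfl⟩ : ∃ w', fderiv ℝ ψ x w' = w :=
    (LinearMap.injective_iff_surjective (f := (fderiv ℝ ψ x).toLinearMap)).1 (h.injective x hx) w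
  rw [← h.apply_eq x hx, h.isMetricOn_pullback.apply_christoffel hx, h.fderiv_apply hx,
    h.fderiv_apply hx, h.fderiv_apply hx, map_add, add_apply, hG.apply_christoffel hψ,
    h.fderiv_fderiv_symm hx v u, h.fderiv_fderiv_symm hx w u, h.fderiv_fderiv_symm hx w v,
    hG.symm _ hψ (fderiv ℝ ψ x v), hG.symm _ hψ (fderiv ℝ ψ x u)]
  ring

theorem fderiv_fderiv_christoffel_apply (h : IsPullbackOn G' G ψ V U) (hx : x ∈ V) (a u v : E) :
    fderiv ℝ (fderiv ℝ ψ) x a (christoffel G' x u v)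
        + fderiv ℝ ψ x (fderiv ℝ (christoffel G') x a u v) =
      fderiv ℝ (fderiv ℝ (fderiv ℝ ψ)) x a u v
        + fderiv ℝ (christoffel G) (ψ x) (fderiv ℝ ψ x a) (fderiv ℝ ψ x u) (fderiv ℝ ψ x v)
        + christoffel G (ψ x) (fderiv ℝ (fderiv ℝ ψ) x a u) (fderiv ℝ ψ x v)
        + christoffel G (ψ x) (fderiv ℝ ψ x u) (fderiv ℝ (fderiv ℝ ψ) x a v) := by
  have hΓ := h.isMetricOn.differentiableAt_christoffel (h.mapsTo hx)
  have hΓ' := (h.isMetricOn_pullback.differentiableAt_christoffel hx).hasFDerivAt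
  have hψ' := h.contDiffAt_fderiv hx
  have hψ'' := differentiableAt_fderiv (hψ'.of_le (by norm_cast))
  have transformation : (fun y => fderiv ℝ ψ y (christoffel G' y u v)) =ᶠ[nhds x]
      fun y => fderiv ℝ (fderiv ℝ ψ) y u v
        + christoffel G (ψ y) (fderiv ℝ ψ y u) (fderiv ℝ ψ y v) :=
    Filter.eventually_of_mem (h.mem_nhds hx) fun y hy => h.fderiv_christoffel_apply hy u v
  have hleft := (hψ'.differentiableAt (by simp)).hasFDerivAt.clm_apply
    ((hΓ'.clm_apply (hasFDerivAt_const u x)).clm_apply (hasFDerivAt_const v x))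
  have hright := ((hψ''.hasFDerivAt.clm_apply (hasFDerivAt_const u x)).clm_apply
    (hasFDerivAt_const v x)).fun_add (((h.hasFDerivAt_comp hx hΓ).clm_apply
    (h.hasFDerivAt_fderiv_apply hx u)).clm_apply (h.hasFDerivAt_fderiv_apply hx v))
  have derivs := hleft.fderiv.symm.trans (transformation.fderiv_eq.trans hright.fderiv)
  have := DFunLike.congr_fun derivs a
  simp only [add_apply, ContinuousLinearMap.comp_apply,
    ContinuousLinearMap.flip_apply, zero_apply, map_zero, zero_add] at this
  rw [add_comm, this]
  abel

theorem fderiv_curvature_apply (h : IsPullbackOn G' G ψ V U) (hx : x ∈ V) (u v w : E) :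
    fderiv ℝ ψ x (curvature G' x v w u) =
      curvature G (ψ x) (fderiv ℝ ψ x v) (fderiv ℝ ψ x w) (fderiv ℝ ψ x u) := by
  have derivUV := h.fderiv_fderiv_christoffel_apply hx u v w
  have derivVU := h.fderiv_fderiv_christoffel_apply hx v u w
  have third : fderiv ℝ (fderiv ℝ (fderiv ℝ ψ)) x u v = fderiv ℝ (fderiv ℝ (fderiv ℝ ψ)) x v u :=
    fderiv_fderiv_comm ((h.contDiffAt_fderiv hx).of_le (by norm_cast)) u v
  rw [third] at derivUV
  rw [h.fderiv_fderiv_symm hx v u] at derivVU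
  simp only [curvature_apply, map_add, map_sub, h.fderiv_christoffel_apply hx]
  rw [eq_sub_of_add_eq' derivUV, eq_sub_of_add_eq' derivVU]
  abel

end IsPullbackOn

end Pullback

end LocalMetric

/-- An algebraic curvature tensor, as a function of four arguments which are either vectors or the
indices of a frame; `T u v w z` stands for `⟨R(u, v) w, z⟩`, so that `T u v v u` is a sectional
curvature when `u` and `v` are orthonormal. -/
structure IsCurvatureTensor {ι : Type*} (T : ι → ι → ι → ι → ℝ) : Prop where
  antisymm : ∀ i j k l, T i j k l = -T j i k l
  skew : ∀ i j k l, T i j k l = -T i j l k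
  bianchi : ∀ i j k l, T i j k l + T j k i l + T k i j l = 0

/-- The components in an orthonormal frame of an algebraic curvature tensor with vanishing Ricci
contraction. -/
structure IsWeylTensor {ι : Type*} [Fintype ι] (T : ι → ι → ι → ι → ℝ) : Prop
    extends IsCurvatureTensor T where
  ricci : ∀ j k, ∑ i, T i j k i = 0

namespace IsCurvatureTensor

variable {ι : Type*} {T : ι → ι → ι → ι → ℝ}

theorem comp {κ : Type*} (h : IsCurvatureTensor T) (e : κ → ι) :
    IsCurvatureTensor fun i j k l => T (e i) (e j) (e k) (e l) where
  antisymm _ _ _ _ := h.antisymm _ _ _ _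
  skew _ _ _ _ := h.skew _ _ _ _
  bianchi _ _ _ _ := h.bianchi _ _ _ _

theorem self_left (h : IsCurvatureTensor T) (i k l : ι) : T i i k l = 0 :=
  self_eq_neg.1 (h.antisymm i i k l)

theorem self_right (h : IsCurvatureTensor T) (i j k : ι) : T i j k k = 0 :=
  self_eq_neg.1 (h.skew i j k k)

theorem pair_symm (h : IsCurvatureTensor T) (i j k l : ι) : T i j k l = T k l i j := by
  linarith [h.bianchi i j k l, h.bianchi j k l i, h.bianchi k l i j, h.bianchi l i j k,
    h.antisymm i j k l, h.antisymm k l i j, h.skew i j k l, h.skew k l i j,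
    h.antisymm j k i l, h.skew j k i l, h.antisymm k i j l, h.skew k i j l,
    h.antisymm k l j i, h.antisymm l j k i, h.skew l j k i, h.antisymm j k l i, h.skew j k l i,
    h.antisymm l i k j, h.skew l i k j, h.antisymm i k l j, h.skew i k l j,
    h.antisymm i j l k, h.skew i j l k, h.antisymm j l i k, h.skew j l i k,
    h.antisymm l i j k, h.skew l i j k]

theorem flip (h : IsCurvatureTensor T) (i j k l : ι) : T i j k l = T j i l k := by
  rw [h.antisymm, h.skew, neg_neg]

theorem reverse (h : IsCurvatureTensor T) (i j k l : ι) : T i j k l = T l k j i := by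
  rw [h.pair_symm, h.flip]

theorem sub_swap (h : IsCurvatureTensor T) (i j k l : ι) :
    T i k l j - T i l k j = T i j l k := by
  linarith [h.bianchi i k l j, h.antisymm l i k j, h.pair_symm k l i j, h.skew i j k l]

end IsCurvatureTensor

namespace IsWeylTensor

section Laplacian

variable {ι : Type*} [Fintype ι] {T : ι → ι → ι → ι → ℝ}

theorem ricci_first_third (h : IsWeylTensor T) (j k : ι) : ∑ i, T j i k i = 0 := by
  simp only [fun i => h.antisymm j i k i, Finset.sum_neg_distrib, h.ricci, neg_zero]

theorem ricci_middle (h : IsWeylTensor T) (j k : ι) : ∑ i, T j i i k = 0 := by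
  simp only [fun i => h.skew j i i k, Finset.sum_neg_distrib, h.ricci_first_third, neg_zero]

variable {N : ι → ι → ι → ι → ι → ι → ℝ}

theorem sum_hess_eq_sum_commutators (hN : ∀ m n, IsWeylTensor (N m n))
    (hB : ∀ m i j k w l, N m i j k w l + N m j k i w l + N m k i j w l = 0) (a b c d : ι) :
    ∑ m, N m m a b c d = ∑ m, (N a m b m c d - N m a b m c d)
      + ∑ m, (N b m m a c d - N m b m a c d) := by
  have contracted (x z : ι) : ∑ m, N x m z m c d = 0 := by
    have bianchi (m : ι) : N x m z m c d = -N x c d m z m - N x d m c z m := by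
      rw [(hN x m).pair_symm]
      linarith [hB x m c d z m]
    simp only [bianchi, Finset.sum_sub_distrib, Finset.sum_neg_distrib,
      (hN x c).ricci_first_third d z, (hN x d).ricci c z, neg_zero, sub_zero]
  have contracted_flip : ∑ m, N b m m a c d = 0 := by
    simp only [fun m => (hN b m).antisymm m a, Finset.sum_neg_distrib, contracted, neg_zero]
  have bianchi (m : ι) : N m m a b c d = -N m a b m c d - N m b m a c d := by
    linarith [hB m m a b c d]
  simp only [bianchi, Finset.sum_sub_distrib, Finset.sum_neg_distrib, contracted, contracted_flip]
  ring

theorem sum_hess_eq_quadratic (h : IsWeylTensor T) (hN : ∀ m n, IsWeylTensor (N m n))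
    (hB : ∀ m i j k w l, N m i j k w l + N m j k i w l + N m k i j w l = 0)
    (hR : ∀ m n i j k l, N m n i j k l - N n m i j k l =
      -∑ p, (T m n i p * T p j k l + T m n j p * T i p k l + T m n k p * T i j p l
        + T m n l p * T i j k p)) (a b : ι) :
    ∑ m, N m m a b b a =
      2 * ∑ m, ∑ p, (T a m p b * T a p m b - T a m p a * T b m p b)
        - ∑ m, ∑ p, T a b m p ^ 2 := by
  have ricci_mul (x : ι) (f : ι → ℝ) : ∑ m, ∑ p, T x m m p * f p = 0 := by
    rw [Finset.sum_comm]
    simp only [← Finset.sum_mul, h.ricci_middle, zero_mul, Finset.sum_const_zero]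
  have commutators (m p : ι) :
      -(T a m b p * T p m b a + T a m m p * T b p b a + T a m b p * T b m p a
          + T a m a p * T b m b p)
        + -(T b m m p * T p a b a + T b m a p * T m p b a + T b m b p * T m a p a
          + T b m a p * T m a b p) =
      2 * (T a m p b * T a p m b - T a m p a * T b m p b) - T a b m p ^ 2
        - T a m m p * T b p b a - T b m m p * T p a b a := by
    have swap := h.sub_swap a b m p
    rw [h.skew a b p m] at swap
    rw [h.antisymm m p b a, h.antisymm m a p a, h.flip m a b p, h.skew a m b p, h.skew b m a p,
      h.skew a m a p, h.skew b m b p, h.reverse p m b a, h.reverse b m p a]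
    linear_combination T a b m p * swap
  rw [sum_hess_eq_sum_commutators hN hB]
  simp only [hR, ← Finset.sum_neg_distrib, ← Finset.sum_add_distrib, commutators,
    Finset.sum_sub_distrib, ← Finset.mul_sum, ricci_mul, sub_zero]

end Laplacian

section DimFour

variable {T : Fin 4 → Fin 4 → Fin 4 → Fin 4 → ℝ}

theorem apply_0330 (h : IsWeylTensor T) : T 0 3 3 0 = -T 0 1 1 0 - T 0 2 2 0 := by
  have := h.ricci 0 0
  simp only [Fin.sum_univ_four, h.self_left, h.flip _ 0 0] at this
  linarith

theorem apply_1221 (h : IsWeylTensor T) : T 1 2 2 1 = -T 0 1 1 0 - T 0 2 2 0 := by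
  have r0 := h.ricci 0 0
  have r1 := h.ricci 1 1
  have r2 := h.ricci 2 2
  have r3 := h.ricci 3 3
  simp only [Fin.sum_univ_four, h.self_left, h.flip _ 0 0, h.flip 2 1, h.flip 3 1,
    h.flip 3 2] at r0 r1 r2 r3
  linarith

theorem apply_1331 (h : IsWeylTensor T) : T 1 3 3 1 = T 0 2 2 0 := by
  have := h.ricci 1 1
  simp only [Fin.sum_univ_four, h.self_left, h.flip 2 1, h.flip 3 1, h.apply_1221] at this
  linarith

theorem apply_0331 (h : IsWeylTensor T) : T 0 3 3 1 = -T 0 2 2 1 := by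
  have := h.ricci 0 1
  simp only [Fin.sum_univ_four, h.self_left, h.self_right, h.flip _ 0 1] at this
  linarith

theorem apply_1231 (h : IsWeylTensor T) : T 1 2 3 1 = -T 0 2 3 0 := by
  have := h.ricci 2 3
  simp only [Fin.sum_univ_four, h.self_left, h.self_right] at this
  linarith

theorem apply_0321 (h : IsWeylTensor T) : T 0 3 2 1 = T 0 2 3 1 + T 0 1 2 3 := by
  linarith [h.sub_swap 0 1 2 3, h.skew 0 1 2 3]

/-- The vanishing components say that the plane of the first two frame vectors is critical for the
sectional curvature. -/
theorem quadratic_eq_of_critical (h : IsWeylTensor T)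
    (h2 : T 2 1 1 0 = 0) (h3 : T 3 1 1 0 = 0) (h2' : T 0 2 1 0 = 0) (h3' : T 0 3 1 0 = 0) :
    2 * ∑ m, ∑ p, (T 0 m p 1 * T 0 p m 1 - T 0 m p 0 * T 1 m p 1) - ∑ m, ∑ p, T 0 1 m p ^ 2 =
      -3 * (T 0 1 1 0 ^ 2 + T 0 1 2 3 ^ 2)
        + 4 * ((T 0 2 2 0 + T 0 1 1 0 / 2) ^ 2 + T 0 2 2 1 ^ 2 + T 0 2 3 0 ^ 2
          + (T 0 2 3 1 + T 0 1 2 3 / 2) ^ 2) := by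
  have z0120 : T 0 1 2 0 = 0 := by rw [h.reverse, h2']
  have z0130 : T 0 1 3 0 = 0 := by rw [h.reverse, h3']
  have z0121 : T 0 1 2 1 = 0 := by rw [h.pair_symm, h.skew, h2, neg_zero]
  have z0131 : T 0 1 3 1 = 0 := by rw [h.pair_symm, h.skew, h3, neg_zero]
  simp only [Fin.sum_univ_four, h.self_left, h.self_right, h2', h3', z0120, z0130, z0121, z0131,
    h.skew 0 1 0 1, h.skew 0 1 0 2, h.skew 0 1 0 3, h.skew 0 1 1 2, h.skew 0 1 1 3,
    h.skew 0 1 3 2, h.skew 0 2 0 1, h.skew 0 3 0 1, h.reverse 0 3 2 0, h.reverse 1 3 2 1,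
    h.apply_0321, h.apply_0330, h.apply_0331, h.apply_1221, h.apply_1231, h.apply_1331]
  ring

theorem three_mul_sq_le_of_pinched (h : IsWeylTensor T) {κ : ℝ}
    (hQ : 0 ≤ -3 * (T 0 1 1 0 ^ 2 + T 0 1 2 3 ^ 2)
      + 4 * ((T 0 2 2 0 + T 0 1 1 0 / 2) ^ 2 + T 0 2 2 1 ^ 2 + T 0 2 3 0 ^ 2
        + (T 0 2 3 1 + T 0 1 2 3 / 2) ^ 2))
    (h2 : T 0 2 2 1 ^ 2 ≤ (κ - T 0 2 2 0) * (κ - T 1 2 2 1))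
    (h23 : (T 0 2 2 1 + T 0 2 3 1 + T 0 3 2 1 + T 0 3 3 1) ^ 2 ≤
      (2 * κ - (T 0 2 2 0 + 2 * T 0 2 3 0 + T 0 3 3 0)) *
      (2 * κ - (T 1 2 2 1 + 2 * T 1 2 3 1 + T 1 3 3 1))) :
    3 * T 0 1 1 0 ^ 2 ≤ 8 * (κ + T 0 1 1 0 / 2) ^ 2 := by
  rw [h.apply_1221] at h2
  rw [h.apply_1221, h.apply_0330, h.apply_1231, h.apply_1331, h.apply_0331, h.apply_0321] at h23
  have disk_e2 : (T 0 2 2 0 + T 0 1 1 0 / 2) ^ 2 + T 0 2 2 1 ^ 2 ≤ (κ + T 0 1 1 0 / 2) ^ 2 := by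
    linarith
  have disk_e23 : T 0 2 3 0 ^ 2 + (T 0 2 3 1 + T 0 1 2 3 / 2) ^ 2 ≤ (κ + T 0 1 1 0 / 2) ^ 2 := by
    linarith
  linarith [disk_e2, disk_e23, sq_nonneg (T 0 1 2 3)]

end DimFour

end IsWeylTensor

namespace LocalMetric

section SecondCovariantDerivative

variable {E : Type*} [NormedAddCommGroup E] [NormedSpace ℝ E] [FiniteDimensional ℝ E]

/-- The covariant curvature tensor `G(R(u, v) w, z)`. -/
noncomputable def curvatureTensor (G : E → E →L[ℝ] E →L[ℝ] ℝ) (y u v w z : E) : ℝ :=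
  G y (curvature G y v w u) z

/-- At a point where the Christoffel symbols vanish, the second covariant derivative
`(∇²_{m,n} R)(u, v) w` of the curvature: only derivatives of the Christoffel symbols survive in the
correction terms. -/
noncomputable def curvatureHess (G : E → E →L[ℝ] E →L[ℝ] ℝ) (y m n u v w : E) : E :=
  fderiv ℝ (fderiv ℝ fun x => curvature G x v w u) y m n
    + fderiv ℝ (christoffel G) y m n (curvature G y v w u)
    - curvature G y v w (fderiv ℝ (christoffel G) y m n u)
    - curvature G y (fderiv ℝ (christoffel G) y m n v) w u
    - curvature G y v (fderiv ℝ (christoffel G) y m n w) u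

variable {G : E → E →L[ℝ] E →L[ℝ] ℝ} {U : Set E} {y : E}

theorem curvature_apply_of_christoffel_eq_zero (hΓ : christoffel G y = 0) (u v w : E) :
    curvature G y v w u =
      fderiv ℝ (christoffel G) y u v w - fderiv ℝ (christoffel G) y v u w := by
  simp [curvature_apply, hΓ]

namespace IsMetricOn

theorem isCurvatureTensor (hG : IsMetricOn G U) (hy : y ∈ U) :
    IsCurvatureTensor (curvatureTensor G y) where
  antisymm u v w z := by simp [curvatureTensor, curvature_antisymm u v w]
  skew u v w z := hG.curvature_skew hy u v w z
  bianchi u v w z := by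
    simp only [curvatureTensor, ← add_apply, ← map_add, hG.curvature_bianchi hy u v w, map_zero,
      zero_apply]

theorem contDiffAt_fderiv_christoffel (hG : IsMetricOn G U) (hy : y ∈ U) :
    ContDiffAt ℝ ∞ (fderiv ℝ (christoffel G)) y :=
  (hG.contDiffAt_christoffel hy).fderiv_right (by simp)

theorem contDiffAt_fderiv_christoffel_apply (hG : IsMetricOn G U) (hy : y ∈ U) (u v w : E) :
    ContDiffAt ℝ ∞ (fun x => fderiv ℝ (christoffel G) x u v w) y :=
  (((hG.contDiffAt_fderiv_christoffel hy).clm_apply contDiffAt_const).clm_apply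
    contDiffAt_const).clm_apply contDiffAt_const

theorem contDiffAt_christoffel_apply (hG : IsMetricOn G U) (hy : y ∈ U) (u v : E) :
    ContDiffAt ℝ ∞ (fun x => christoffel G x u v) y :=
  ((hG.contDiffAt_christoffel hy).clm_apply contDiffAt_const).clm_apply contDiffAt_const

theorem contDiffAt_christoffel_christoffel (hG : IsMetricOn G U) (hy : y ∈ U) (u v w : E) :
    ContDiffAt ℝ ∞ (fun x => christoffel G x u (christoffel G x v w)) y :=
  ((hG.contDiffAt_christoffel hy).clm_apply contDiffAt_const).clm_apply
    (hG.contDiffAt_christoffel_apply hy v w)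

theorem contDiffAt_curvature (hG : IsMetricOn G U) (hy : y ∈ U) (u v w : E) :
    ContDiffAt ℝ ∞ (fun x => curvature G x v w u) y :=
  (((hG.contDiffAt_fderiv_christoffel_apply hy u v w).sub
    (hG.contDiffAt_fderiv_christoffel_apply hy v u w)).add
    (hG.contDiffAt_christoffel_christoffel hy u v w)).sub
    (hG.contDiffAt_christoffel_christoffel hy v u w)

theorem contDiffAt_curvatureTensor (hG : IsMetricOn G U) (hy : y ∈ U) (u v w z : E) :
    ContDiffAt ℝ ∞ (fun x => curvatureTensor G x u v w z) y :=
  ((hG.contDiffAt hy).clm_apply (hG.contDiffAt_curvature hy u v w)).clm_apply contDiffAt_const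

theorem fderiv_fderiv_christoffel_christoffel (hG : IsMetricOn G U) (hy : y ∈ U)
    (hΓ : christoffel G y = 0) (m n u v w : E) :
    fderiv ℝ (fderiv ℝ fun x => christoffel G x u (christoffel G x v w)) y m n =
      fderiv ℝ (christoffel G) y m u (fderiv ℝ (christoffel G) y n v w)
      + fderiv ℝ (christoffel G) y n u (fderiv ℝ (christoffel G) y m v w) := by
  have hd := hG.differentiableAt_christoffel hy
  rw [fderiv_fderiv_clm_apply (((hG.contDiffAt_christoffel hy).clm_apply contDiffAt_const).of_le
    (by norm_cast)) ((hG.contDiffAt_christoffel_apply hy v w).of_le (by norm_cast))]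
  simp [hΓ, fderiv_clm_apply_const hd, fderiv_clm_apply₂_const hd]

theorem fderiv_fderiv_fderiv_christoffel_apply (hG : IsMetricOn G U) (hy : y ∈ U)
    (m n u v w : E) :
    fderiv ℝ (fderiv ℝ fun x => fderiv ℝ (christoffel G) x u v w) y m n =
      fderiv ℝ (fderiv ℝ (fderiv ℝ (christoffel G))) y m n u v w := by
  have smooth : ContDiffAt ℝ 2 (fderiv ℝ (christoffel G)) y :=
    (hG.contDiffAt_fderiv_christoffel hy).of_le (by norm_cast)
  rw [fderiv_fderiv_clm_apply₂_const (smooth.clm_apply contDiffAt_const),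
    fderiv_fderiv_clm_apply_const smooth]

theorem fderiv_fderiv_fderiv_christoffel_symm (hG : IsMetricOn G U) (hy : y ∈ U) (m n u : E) :
    fderiv ℝ (fderiv ℝ (fderiv ℝ (christoffel G))) y m n u =
      fderiv ℝ (fderiv ℝ (fderiv ℝ (christoffel G))) y m u n := by
  have hd : DifferentiableAt ℝ (fderiv ℝ (fderiv ℝ (christoffel G))) y :=
    differentiableAt_fderiv ((hG.contDiffAt_fderiv_christoffel hy).of_le (by norm_cast))
  exact fderiv_apply_comm_of_eventually hd (Filter.eventually_of_mem (hG.mem_nhds hy)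
    fun x hx => fderiv_fderiv_comm ((hG.contDiffAt_christoffel hx).of_le (by norm_cast)) n u) m

theorem fderiv_fderiv_curvature (hG : IsMetricOn G U) (hy : y ∈ U)
    (hΓ : christoffel G y = 0) (m n u v w : E) :
    fderiv ℝ (fderiv ℝ fun x => curvature G x v w u) y m n =
      fderiv ℝ (fderiv ℝ (fderiv ℝ (christoffel G))) y m n u v w
      - fderiv ℝ (fderiv ℝ (fderiv ℝ (christoffel G))) y m n v u w
      + (fderiv ℝ (christoffel G) y m u (fderiv ℝ (christoffel G) y n v w)
        + fderiv ℝ (christoffel G) y n u (fderiv ℝ (christoffel G) y m v w))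
      - (fderiv ℝ (christoffel G) y m v (fderiv ℝ (christoffel G) y n u w)
        + fderiv ℝ (christoffel G) y n v (fderiv ℝ (christoffel G) y m u w)) := by
  have linear (u v w : E) : ContDiffAt ℝ 2 (fun x => fderiv ℝ (christoffel G) x u v w) y :=
    (hG.contDiffAt_fderiv_christoffel_apply hy u v w).of_le (by norm_cast)
  have quadratic (u v w : E) :
      ContDiffAt ℝ 2 (fun x => christoffel G x u (christoffel G x v w)) y :=
    (hG.contDiffAt_christoffel_christoffel hy u v w).of_le (by norm_cast)
  simp only [curvature_apply]
  rw [fderiv_fderiv_sub (((linear u v w).sub (linear v u w)).add (quadratic u v w))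
      (quadratic v u w),
    fderiv_fderiv_add ((linear u v w).sub (linear v u w)) (quadratic u v w),
    fderiv_fderiv_sub (linear u v w) (linear v u w),
    hG.fderiv_fderiv_fderiv_christoffel_apply hy, hG.fderiv_fderiv_fderiv_christoffel_apply hy,
    hG.fderiv_fderiv_christoffel_christoffel hy hΓ,
    hG.fderiv_fderiv_christoffel_christoffel hy hΓ]

theorem exists_curvatureHess_eq (hG : IsMetricOn G U) (hy : y ∈ U) (hΓ : christoffel G y = 0) :
    ∃ (H : E → E → E → E) (X : E → E → E → E → E → E),
      (∀ m n u v w, curvatureHess G y m n u v w =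
        X m n u v w - X m n v u w + (H m u (H n v w) + H n u (H m v w))
        - (H m v (H n u w) + H n v (H m u w)) + (H m n (H u v w) - H m n (H v u w))
        - (H (H m n u) v w - H v (H m n u) w) - (H u (H m n v) w - H (H m n v) u w)
        - (H u v (H m n w) - H v u (H m n w))) ∧
      (∀ m u v, H m u v = H m v u) ∧ ∀ m n u v w, X m n u v w = X m u n v w := by
  refine ⟨fun m u v => fderiv ℝ (christoffel G) y m u v,
    fun m n u v w => fderiv ℝ (fderiv ℝ (fderiv ℝ (christoffel G))) y m n u v w,
    fun m n u v w => ?_, hG.fderiv_christoffel_symm hy,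
    fun m n u v w => congr($(hG.fderiv_fderiv_fderiv_christoffel_symm hy m n u) v w)⟩
  simp only [curvatureHess, hG.fderiv_fderiv_curvature hy hΓ,
    curvature_apply_of_christoffel_eq_zero hΓ, ContinuousLinearMap.map_sub]

theorem curvatureHess_antisymm (hG : IsMetricOn G U) (hy : y ∈ U) (hΓ : christoffel G y = 0)
    (m n u v w : E) :
    curvatureHess G y m n u v w = -curvatureHess G y m n v u w := by
  obtain ⟨H, X, formula, -, -⟩ := hG.exists_curvatureHess_eq hy hΓ
  rw [formula, formula]
  abel

theorem curvatureHess_second_bianchi (hG : IsMetricOn G U) (hy : y ∈ U)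
    (hΓ : christoffel G y = 0) (m i j k w : E) :
    curvatureHess G y m i j k w + curvatureHess G y m j k i w
      + curvatureHess G y m k i j w = 0 := by
  obtain ⟨H, X, formula, symmH, symmX⟩ := hG.exists_curvatureHess_eq hy hΓ
  rw [formula, formula, formula, symmX m j i, symmX m k i, symmX m k j, symmH m i j, symmH m j k,
    symmH m i k]
  abel

theorem curvatureHess_ricci_identity (hG : IsMetricOn G U) (hy : y ∈ U) (hΓ : christoffel G y = 0)
    (m n u v w : E) :
    curvatureHess G y m n u v w - curvatureHess G y n m u v w =
      curvature G y n (curvature G y v w u) m - curvature G y v w (curvature G y n u m)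
      - curvature G y (curvature G y n v m) w u - curvature G y v (curvature G y n w m) u := by
  simp only [curvatureHess]
  rw [fderiv_fderiv_comm ((hG.contDiffAt_curvature hy u v w).of_le (by norm_cast)) m n]
  simp only [curvature_apply_of_christoffel_eq_zero hΓ, map_sub, sub_apply]
  abel

theorem fderiv_fderiv_curvature_bianchi (hG : IsMetricOn G U) (hy : y ∈ U) (m n u v w : E) :
    fderiv ℝ (fderiv ℝ fun x => curvature G x v w u) y m n
      + fderiv ℝ (fderiv ℝ fun x => curvature G x w u v) y m n
      + fderiv ℝ (fderiv ℝ fun x => curvature G x u v w) y m n = 0 := by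
  have smooth (u v w : E) : ContDiffAt ℝ 2 (fun x => curvature G x v w u) y :=
    (hG.contDiffAt_curvature hy u v w).of_le (by norm_cast)
  have bianchi : (fun x => curvature G x v w u + curvature G x w u v + curvature G x u v w)
      =ᶠ[nhds y] fun _ => 0 :=
    Filter.eventually_of_mem (hG.mem_nhds hy) fun x hx => hG.curvature_bianchi hx u v w
  rw [← fderiv_fderiv_add (smooth u v w) (smooth v w u),
    ← fderiv_fderiv_add ((smooth u v w).add (smooth v w u)) (smooth w u v),
    bianchi.fderiv.fderiv_eq]
  simp

theorem curvatureHess_first_bianchi (hG : IsMetricOn G U) (hy : y ∈ U) (m n u v w : E) :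
    curvatureHess G y m n u v w + curvatureHess G y m n v w u
      + curvatureHess G y m n w u v = 0 := by
  set H := fderiv ℝ (christoffel G) y m n
  have bianchi := hG.curvature_bianchi hy
  have outer := congrArg H (bianchi u v w)
  simp only [map_add, map_zero] at outer
  simp only [curvatureHess]
  linear_combination (norm := module) hG.fderiv_fderiv_curvature_bianchi hy m n u v w + outer
    - bianchi (H u) v w - bianchi u (H v) w - bianchi u v (H w)

theorem fderiv_eq_zero (hG : IsMetricOn G U) (hy : y ∈ U) (hΓ : christoffel G y = 0) :
    fderiv ℝ G y = 0 := by
  ext u v w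
  simp [hG.fderiv_eq hy, hΓ]

theorem fderiv_fderiv_apply_of_christoffel_eq_zero (hG : IsMetricOn G U) (hy : y ∈ U)
    (hΓ : christoffel G y = 0) (u v w z : E) :
    fderiv ℝ (fderiv ℝ G) y u v w z =
      G y (fderiv ℝ (christoffel G) y u v w) z + G y w (fderiv ℝ (christoffel G) y u v z) := by
  simp [hG.fderiv_fderiv_apply hy, hΓ]

theorem fderiv_fderiv_curvatureTensor (hG : IsMetricOn G U) (hy : y ∈ U)
    (hΓ : christoffel G y = 0) (m n u v w z : E) :
    fderiv ℝ (fderiv ℝ fun x => curvatureTensor G x u v w z) y m n =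
      G y (curvatureHess G y m n u v w) z
      + curvatureTensor G y (fderiv ℝ (christoffel G) y m n u) v w z
      + curvatureTensor G y u (fderiv ℝ (christoffel G) y m n v) w z
      + curvatureTensor G y u v (fderiv ℝ (christoffel G) y m n w) z
      + curvatureTensor G y u v w (fderiv ℝ (christoffel G) y m n z) := by
  have smoothG : ContDiffAt ℝ 2 G y := (hG.contDiffAt hy).of_le (by norm_cast)
  have smooth : ContDiffAt ℝ 2 (fun x => curvature G x v w u) y :=
    (hG.contDiffAt_curvature hy u v w).of_le (by norm_cast)
  simp only [curvatureTensor]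
  rw [fderiv_fderiv_clm_apply_const (smoothG.clm_apply smooth),
    fderiv_fderiv_clm_apply smoothG smooth, hG.fderiv_eq_zero hy hΓ]
  simp only [curvatureHess, add_apply, zero_apply, map_add, map_sub, sub_apply, add_zero,
    hG.fderiv_fderiv_apply_of_christoffel_eq_zero hy hΓ]
  ring

theorem curvatureHess_skew (hG : IsMetricOn G U) (hy : y ∈ U) (hΓ : christoffel G y = 0)
    (m n u v w z : E) :
    G y (curvatureHess G y m n u v w) z = -G y (curvatureHess G y m n u v z) w := by
  have skew : (fun x => curvatureTensor G x u v w z) =ᶠ[nhds y]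
      fun x => (-1 : ℝ) • curvatureTensor G x u v z w :=
    Filter.eventually_of_mem (hG.mem_nhds hy) fun x hx => by
      simpa using (hG.isCurvatureTensor hx).skew u v w z
  have second := congr($((skew.fderiv (𝕜 := ℝ)).fderiv_eq (𝕜 := ℝ)) m n)
  rw [fderiv_fderiv_const_smul ((hG.contDiffAt_curvatureTensor hy u v z w).of_le (by norm_cast)),
    neg_one_smul, hG.fderiv_fderiv_curvatureTensor hy hΓ,
    hG.fderiv_fderiv_curvatureTensor hy hΓ] at second
  have s := (hG.isCurvatureTensor hy).skew
  set H := fderiv ℝ (christoffel G) y m n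
  linear_combination second - s (H u) v w z - s u (H v) w z - s u v (H w) z - s u v w (H z)

theorem isCurvatureTensor_curvatureHess (hG : IsMetricOn G U) (hy : y ∈ U)
    (hΓ : christoffel G y = 0) (m n : E) :
    IsCurvatureTensor fun u v w z => G y (curvatureHess G y m n u v w) z where
  antisymm u v w z := by simp [hG.curvatureHess_antisymm hy hΓ m n u v w]
  skew u v w z := hG.curvatureHess_skew hy hΓ m n u v w z
  bianchi u v w z := by
    have bianchi := congrArg (fun a => G y a z) (hG.curvatureHess_first_bianchi hy m n u v w)
    simpa only [map_add, map_zero, add_apply, zero_apply] using bianchi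

end IsMetricOn

end SecondCovariantDerivative

section Trace

variable {E : Type*} [NormedAddCommGroup E] [NormedSpace ℝ E]
  {ι : Type*} [Fintype ι] (b : Module.Basis ι ℝ E)

theorem trace_eq_sum_repr (f : E →ₗ[ℝ] E) : LinearMap.trace ℝ E f = ∑ i, b.repr (f (b i)) i := by
  classical
  simp [LinearMap.trace_eq_matrix_trace ℝ b, Matrix.trace, LinearMap.toMatrix_apply]

variable [FiniteDimensional ℝ E] {G : E → E →L[ℝ] E →L[ℝ] ℝ} {U : Set E} {y : E}

namespace IsMetricOn

theorem sum_repr_fderiv_fderiv_curvature_eq_zero (hG : IsMetricOn G U) (hy : y ∈ U)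
    (hRic : ∀ x ∈ U, ∀ v w, LinearMap.trace ℝ E (curvature G x v w) = 0) (m n v w : E) :
    ∑ i, b.repr (fderiv ℝ (fderiv ℝ fun x => curvature G x v w (b i)) y m n) i = 0 := by
  set coord : ι → E →L[ℝ] ℝ := fun i => LinearMap.toContinuousLinearMap (b.coord i)
  have smooth (i : ι) : ContDiffAt ℝ 2 (fun x => curvature G x v w (b i)) y :=
    (hG.contDiffAt_curvature hy (b i) v w).of_le (by norm_cast)
  have ricci : (fun x => ∑ i, coord i (curvature G x v w (b i))) =ᶠ[nhds y] fun _ => 0 :=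
    Filter.eventually_of_mem (hG.mem_nhds hy) fun x hx =>
      (trace_eq_sum_repr b _).symm.trans (hRic x hx v w)
  calc ∑ i, coord i (fderiv ℝ (fderiv ℝ fun x => curvature G x v w (b i)) y m n)
      = ∑ i, fderiv ℝ (fderiv ℝ fun x => coord i (curvature G x v w (b i))) y m n := by
        simp only [fderiv_fderiv_const_clm_apply _ (smooth _)]
    _ = fderiv ℝ (fderiv ℝ fun x => ∑ i, coord i (curvature G x v w (b i))) y m n :=
        (fderiv_fderiv_sum (fun i => contDiffAt_const.clm_apply (smooth i)) _ m n).symm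
    _ = 0 := by
        rw [ricci.fderiv.fderiv_eq]
        simp

theorem sum_repr_curvatureHess_eq_zero (hG : IsMetricOn G U) (hy : y ∈ U)
    (hRic : ∀ x ∈ U, ∀ v w, LinearMap.trace ℝ E (curvature G x v w) = 0) (m n v w : E) :
    ∑ i, b.repr (curvatureHess G y m n (b i) v w) i = 0 := by
  let H : E →L[ℝ] E := fderiv ℝ (christoffel G) y m n
  have commutator : ∑ i, b.repr (H (curvature G y v w (b i))) i =
      ∑ i, b.repr (curvature G y v w (H (b i))) i := by
    have := LinearMap.trace_mul_comm ℝ H.toLinearMap (curvature G y v w)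
    rwa [trace_eq_sum_repr b, trace_eq_sum_repr b] at this
  have ricci_left := hRic y hy (H v) w
  have ricci_right := hRic y hy v (H w)
  rw [trace_eq_sum_repr b] at ricci_left ricci_right
  simp only [curvatureHess, map_add, map_sub, Finsupp.add_apply, Finsupp.sub_apply,
    Finset.sum_add_distrib, Finset.sum_sub_distrib]
  linear_combination hG.sum_repr_fderiv_fderiv_curvature_eq_zero b hy hRic m n v w + commutator
    - ricci_left - ricci_right

end IsMetricOn

end Trace

end LocalMetric

namespace LocalMetric

section SectionalBounds

variable {E : Type*} [NormedAddCommGroup E] [NormedSpace ℝ E]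

/-- The Gram determinant of two vectors, i.e. the squared area of the parallelogram they span. -/
noncomputable def gram (B : E →L[ℝ] E →L[ℝ] ℝ) (u v : E) : ℝ :=
  B u u * B v v - B u v ^ 2

variable {G : E → E →L[ℝ] E →L[ℝ] ℝ} {U : Set E} {y : E}

theorem IsMetricOn.contDiffAt_apply (hG : IsMetricOn G U) (hy : y ∈ U) (u v : E) :
    ContDiffAt ℝ 2 (fun x => G x u v) y :=
  (((hG.contDiffAt hy).clm_apply contDiffAt_const).clm_apply contDiffAt_const).of_le
    (by norm_cast)

theorem IsMetricOn.contDiffAt_gram (hG : IsMetricOn G U) (hy : y ∈ U) (u v : E) :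
    ContDiffAt ℝ 2 (fun x => gram (G x) u v) y :=
  ((hG.contDiffAt_apply hy u u).mul (hG.contDiffAt_apply hy v v)).sub
    ((hG.contDiffAt_apply hy u v).pow 2)

variable [FiniteDimensional ℝ E]

/-- The bilinear form whose value at `(u, u)` is the defect `c * gram (G y) u w - R(u, w, w, u)` in
the bound `K ≤ c` for the sectional curvature of the plane spanned by `u` and `w`. -/
noncomputable def defectForm (G : E → E →L[ℝ] E →L[ℝ] ℝ) (y : E) (c : ℝ) (w : E) :
    LinearMap.BilinForm ℝ E :=
  LinearMap.mk₂ ℝ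
    (fun u v => c * (G y u v * G y w w - G y u w * G y v w) - curvatureTensor G y u w w v)
    (fun u u' v => by simp only [curvatureTensor, map_add, add_apply]; ring)
    (fun r u v => by simp only [curvatureTensor, map_smul, smul_apply, smul_eq_mul]; ring)
    (fun u v v' => by simp only [curvatureTensor, map_add, add_apply]; ring)
    (fun r u v => by simp only [curvatureTensor, map_smul, smul_apply, smul_eq_mul]; ring)

theorem defectForm_apply (c : ℝ) (u v w : E) : defectForm G y c w u v =
    c * (G y u v * G y w w - G y u w * G y v w) - curvatureTensor G y u w w v :=
  rfl

theorem defectForm_self (c : ℝ) (u w : E) :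
    defectForm G y c w u u = c * gram (G y) u w - curvatureTensor G y u w w u := by
  rw [defectForm_apply, gram, sq]

theorem curvatureTensor_add_middle (u v v' w w' z : E) :
    curvatureTensor G y u (v + v') (w + w') z =
      curvatureTensor G y u v w z + curvatureTensor G y u v w' z
        + (curvatureTensor G y u v' w z + curvatureTensor G y u v' w' z) := by
  simp only [curvatureTensor, curvature_apply, map_add, map_sub, add_apply, sub_apply]
  ring

namespace IsMetricOn

theorem defectForm_isSymm (hG : IsMetricOn G U) (hy : y ∈ U) (c : ℝ) (w : E) :
    LinearMap.IsSymm (defectForm G y c w) where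
  eq u v := by
    simp only [defectForm_apply, RingHom.id_apply, hG.symm y hy v u,
      (hG.isCurvatureTensor hy).reverse v w w u]
    ring

theorem defectForm_sq_le (hG : IsMetricOn G U) (hy : y ∈ U) {c : ℝ} {w : E}
    (hmax : ∀ u, curvatureTensor G y u w w u ≤ c * gram (G y) u w) (u v : E) :
    defectForm G y c w u v ^ 2 ≤ defectForm G y c w u u * defectForm G y c w v v :=
  LinearMap.BilinForm.apply_sq_le_of_symm _
    (fun x => by rw [defectForm_self]; exact sub_nonneg.2 (hmax x))
    (hG.defectForm_isSymm hy c w) u v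

theorem curvatureTensor_eq_of_min (hG : IsMetricOn G U) (hy : y ∈ U) {k : ℝ} {a b : E}
    (ha : G y a a = 1) (hb : G y b b = 1) (hab : G y a b = 0)
    (hk : curvatureTensor G y a b b a = k)
    (hmin : ∀ u v, k * gram (G y) u v ≤ curvatureTensor G y u v v u) (w : E) :
    curvatureTensor G y w b b a = k * G y w a := by
  have nonneg (x : E) : 0 ≤ (-defectForm G y k b) x x := by
    rw [LinearMap.neg_apply, LinearMap.neg_apply, defectForm_self, neg_sub]
    exact sub_nonneg.2 (hmin x b)
  have cauchy := LinearMap.BilinForm.apply_sq_le_of_symm _ nonneg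
    ⟨fun u v => congrArg Neg.neg ((hG.defectForm_isSymm hy k b).eq u v)⟩ w a
  have null : defectForm G y k b a a = 0 := by
    simp [defectForm_self, gram, ha, hb, hab, hk]
  simp only [LinearMap.neg_apply, null, neg_zero, mul_zero, neg_sq] at cauchy
  have zero : defectForm G y k b w a = 0 := by nlinarith
  rw [defectForm_apply, hab, hb] at zero
  linarith

theorem fderiv_fderiv_apply_const (hG : IsMetricOn G U) (hy : y ∈ U) (hΓ : christoffel G y = 0)
    (m u v : E) :
    fderiv ℝ (fderiv ℝ fun x => G x u v) y m m =
      G y (fderiv ℝ (christoffel G) y m m u) v + G y u (fderiv ℝ (christoffel G) y m m v) := by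
  have smooth : ContDiffAt ℝ 2 G y := (hG.contDiffAt hy).of_le (by norm_cast)
  rw [fderiv_fderiv_clm_apply₂_const smooth, hG.fderiv_fderiv_apply_of_christoffel_eq_zero hy hΓ]

theorem fderiv_fderiv_gram (hG : IsMetricOn G U) (hy : y ∈ U) (hΓ : christoffel G y = 0)
    {a b : E} (ha : G y a a = 1) (hb : G y b b = 1) (hab : G y a b = 0) (m : E) :
    fderiv ℝ (fderiv ℝ fun x => gram (G x) a b) y m m =
      2 * G y (fderiv ℝ (christoffel G) y m m a) a
        + 2 * G y (fderiv ℝ (christoffel G) y m m b) b := by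
  have smooth := hG.contDiffAt_apply hy
  have critical (u v : E) : fderiv ℝ (fun x => G x u v) y = 0 := by
    ext w
    simp [fderiv_clm_apply₂_const (hG.differentiableAt hy), hG.fderiv_eq_zero hy hΓ]
  simp only [gram, sq]
  rw [fderiv_fderiv_sub ((smooth a a).mul (smooth b b)) ((smooth a b).mul (smooth a b)),
    fderiv_fderiv_mul_of_fderiv_eq_zero (smooth a a) (smooth b b) (critical b b),
    fderiv_fderiv_mul_of_fderiv_eq_zero (smooth a b) (smooth a b) (critical a b),
    hG.fderiv_fderiv_apply_const hy hΓ, hG.fderiv_fderiv_apply_const hy hΓ, ha, hb, hab,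
    hG.symm y hy a, hG.symm y hy b]
  ring

theorem curvatureHess_nonneg_of_min (hG : IsMetricOn G U) (hy : y ∈ U)
    (hΓ : christoffel G y = 0) {k : ℝ} {a b : E}
    (ha : G y a a = 1) (hb : G y b b = 1) (hab : G y a b = 0)
    (hk : curvatureTensor G y a b b a = k)
    (hmin : ∀ x ∈ U, ∀ u v, k * gram (G x) u v ≤ curvatureTensor G x u v v u) (m : E) :
    0 ≤ G y (curvatureHess G y m m a b b) a := by
  have smoothR : ContDiffAt ℝ 2 (fun x => curvatureTensor G x a b b a) y :=
    (hG.contDiffAt_curvatureTensor hy a b b a).of_le (by norm_cast)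
  have smooth_gram := hG.contDiffAt_gram hy a b
  have localMin :
      IsLocalMin (fun x => curvatureTensor G x a b b a - k • gram (G x) a b) y :=
    Filter.eventually_of_mem (hG.mem_nhds hy) fun x hx => by
      simpa [gram, ha, hb, hab, hk] using hmin x hx a b
  have second := fderiv_fderiv_nonneg_of_isLocalMin (smoothR.sub (smooth_gram.const_smul k))
    localMin m
  rw [fderiv_fderiv_sub smoothR (smooth_gram.const_smul k), fderiv_fderiv_const_smul smooth_gram,
    hG.fderiv_fderiv_gram hy hΓ ha hb hab, hG.fderiv_fderiv_curvatureTensor hy hΓ,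
    smul_eq_mul] at second
  have T := hG.isCurvatureTensor hy
  have first_a := hG.curvatureTensor_eq_of_min hy ha hb hab hk (hmin y hy)
  have first_b := hG.curvatureTensor_eq_of_min hy hb ha ((hG.symm y hy b a).trans hab)
    ((T.flip b a a b).trans hk) (hmin y hy)
  rw [T.flip a _ b a, T.pair_symm a b, T.reverse a b b] at second
  linarith [first_a (fderiv ℝ (christoffel G) y m m a), first_b (fderiv ℝ (christoffel G) y m m b)]

end IsMetricOn

end SectionalBounds

section OrthonormalFrame

variable {E : Type*} [NormedAddCommGroup E] [NormedSpace ℝ E]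
  {ι : Type*} [DecidableEq ι] {b : Module.Basis ι ℝ E} {B : E →L[ℝ] E →L[ℝ] ℝ}

theorem repr_eq_of_orthonormal (hb : ∀ i j, B (b i) (b j) = if i = j then 1 else 0) (x : E)
    (i : ι) : b.repr x i = B x (b i) := by
  have coord_eq : b.coord i = (B.flip (b i)).toLinearMap :=
    b.ext fun j => by simp [hb, Finsupp.single_apply]
  exact congr($coord_eq x)

variable [Fintype ι]

theorem isWeylTensor_of_sum_repr_eq_zero (hb : ∀ i j, B (b i) (b j) = if i = j then 1 else 0)
    {F : E → E → E → E} (hF : IsCurvatureTensor fun u v w z => B (F u v w) z)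
    (hRic : ∀ v w, ∑ i, b.repr (F (b i) v w) i = 0) :
    IsWeylTensor fun i j k l => B (F (b i) (b j) (b k)) (b l) where
  __ := hF.comp b
  ricci j k := by simpa only [repr_eq_of_orthonormal hb] using hRic (b j) (b k)

variable [FiniteDimensional ℝ E] {G : E → E →L[ℝ] E →L[ℝ] ℝ} {U : Set E} {y : E}

theorem curvatureTensor_eq_sum (hb : ∀ i j, G y (b i) (b j) = if i = j then 1 else 0)
    (u v w z : E) :
    curvatureTensor G y u v w z = ∑ p, G y u (b p) * curvatureTensor G y (b p) v w z := by
  conv_lhs => rw [← b.sum_repr u]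
  simp [curvatureTensor, repr_eq_of_orthonormal hb]

namespace IsMetricOn

theorem isWeylTensor (hG : IsMetricOn G U) (hy : y ∈ U)
    (hb : ∀ i j, G y (b i) (b j) = if i = j then 1 else 0)
    (hRic : ∀ v w, LinearMap.trace ℝ E (curvature G y v w) = 0) :
    IsWeylTensor fun i j k l => curvatureTensor G y (b i) (b j) (b k) (b l) :=
  isWeylTensor_of_sum_repr_eq_zero hb (hG.isCurvatureTensor hy) fun v w =>
    (trace_eq_sum_repr b _).symm.trans (hRic v w)

theorem isWeylTensor_curvatureHess (hG : IsMetricOn G U) (hy : y ∈ U) (hΓ : christoffel G y = 0)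
    (hb : ∀ i j, G y (b i) (b j) = if i = j then 1 else 0)
    (hRic : ∀ x ∈ U, ∀ v w, LinearMap.trace ℝ E (curvature G x v w) = 0) (m n : E) :
    IsWeylTensor fun i j k l => G y (curvatureHess G y m n (b i) (b j) (b k)) (b l) :=
  isWeylTensor_of_sum_repr_eq_zero hb (hG.isCurvatureTensor_curvatureHess hy hΓ m n) fun v w =>
    hG.sum_repr_curvatureHess_eq_zero b hy hRic m n v w

theorem ricci_identity_frame (hG : IsMetricOn G U) (hy : y ∈ U) (hΓ : christoffel G y = 0)
    (hb : ∀ i j, G y (b i) (b j) = if i = j then 1 else 0) (m n u v w z : E) :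
    G y (curvatureHess G y m n u v w) z - G y (curvatureHess G y n m u v w) z =
      -∑ p, (curvatureTensor G y m n u (b p) * curvatureTensor G y (b p) v w z
        + curvatureTensor G y m n v (b p) * curvatureTensor G y u (b p) w z
        + curvatureTensor G y m n w (b p) * curvatureTensor G y u v (b p) z
        + curvatureTensor G y m n z (b p) * curvatureTensor G y u v w (b p)) := by
  have T := hG.isCurvatureTensor hy
  have identity := congrArg (fun x => G y x z) (hG.curvatureHess_ricci_identity hy hΓ m n u v w)
  simp only [map_sub, sub_apply] at identity
  change _ = curvatureTensor G y m n (curvature G y v w u) z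
    - curvatureTensor G y (curvature G y n u m) v w z
    - curvatureTensor G y u (curvature G y n v m) w z
    - curvatureTensor G y u v (curvature G y n w m) z at identity
  have fst := curvatureTensor_eq_sum hb (curvature G y n u m) v w z
  have snd : curvatureTensor G y u (curvature G y n v m) w z =
      ∑ p, curvatureTensor G y m n v (b p) * curvatureTensor G y u (b p) w z := by
    simp only [fun x => T.flip u x w z]
    exact curvatureTensor_eq_sum hb _ u z w
  have trd : curvatureTensor G y u v (curvature G y n w m) z =
      ∑ p, curvatureTensor G y m n w (b p) * curvatureTensor G y u v (b p) z := by
    simp only [fun x => T.pair_symm u v x z]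
    exact curvatureTensor_eq_sum hb _ z u v
  have fth : curvatureTensor G y m n (curvature G y v w u) z =
      -∑ p, curvatureTensor G y m n z (b p) * curvatureTensor G y u v w (b p) := by
    simp only [fun x => T.skew m n z x, neg_mul, Finset.sum_neg_distrib, neg_neg,
      fun x => T.pair_symm m n x z]
    simp only [mul_comm]
    exact curvatureTensor_eq_sum hb _ z m n
  rw [identity, fst, snd, trd, fth]
  simp only [Finset.sum_add_distrib]
  change _ - ∑ p, curvatureTensor G y m n u (b p) * _ - _ - _ = _
  ring

end IsMetricOn

end OrthonormalFrame

section DimFour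

variable {E : Type*} [NormedAddCommGroup E] [NormedSpace ℝ E] [FiniteDimensional ℝ E]
  {G : E → E →L[ℝ] E →L[ℝ] ℝ} {U : Set E} {y : E} {b : Module.Basis (Fin 4) ℝ E}

namespace IsMetricOn

theorem three_mul_sq_le_of_christoffel_eq_zero (hG : IsMetricOn G U) (hy : y ∈ U)
    (hΓ : christoffel G y = 0)
    (hRic : ∀ x ∈ U, ∀ v w, LinearMap.trace ℝ E (curvature G x v w) = 0)
    (hb : ∀ i j, G y (b i) (b j) = if i = j then 1 else 0)
    {k κ : ℝ} (hk : curvatureTensor G y (b 0) (b 1) (b 1) (b 0) = k)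
    (hmin : ∀ x ∈ U, ∀ u v, k * gram (G x) u v ≤ curvatureTensor G x u v v u)
    (hmax : ∀ u v, curvatureTensor G y u v v u ≤ κ * gram (G y) u v) :
    3 * k ^ 2 ≤ 8 * (κ + k / 2) ^ 2 := by
  have T := hG.isCurvatureTensor hy
  have W := hG.isWeylTensor hy hb (hRic y hy)
  have first_0 := hG.curvatureTensor_eq_of_min hy (by simp [hb]) (by simp [hb]) (by simp [hb]) hk
    (hmin y hy)
  have first_1 := hG.curvatureTensor_eq_of_min hy (a := b 1) (b := b 0) (by simp [hb])
    (by simp [hb]) (by simp [hb]) ((T.flip _ _ _ _).trans hk) (hmin y hy)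
  have laplacian := W.sum_hess_eq_quadratic
    (fun m n => hG.isWeylTensor_curvatureHess hy hΓ hb hRic (b m) (b n))
    (fun m i j k w l => by
      have := congrArg (fun x => G y x (b l))
        (hG.curvatureHess_second_bianchi hy hΓ (b m) (b i) (b j) (b k) (b w))
      simpa only [map_add, map_zero, add_apply, zero_apply] using this)
    (fun m n i j k l => hG.ricci_identity_frame hy hΓ hb (b m) (b n) (b i) (b j) (b k) (b l)) 0 1
  rw [W.quadratic_eq_of_critical (by simp [first_0, hb]) (by simp [first_0, hb])
    (by rw [T.flip]; simp [first_1, hb]) (by rw [T.flip]; simp [first_1, hb])] at laplacian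
  have disk_e2 := hG.defectForm_sq_le hy (fun u => hmax u (b 2)) (b 0) (b 1)
  have disk_e23 := hG.defectForm_sq_le hy (fun u => hmax u (b 2 + b 3)) (b 0) (b 1)
  rw [← hk]
  refine W.three_mul_sq_le_of_pinched (laplacian ▸ Finset.sum_nonneg fun m _ => ?_) ?_ ?_
  · exact hG.curvatureHess_nonneg_of_min hy hΓ (by simp [hb]) (by simp [hb]) (by simp [hb]) hk hmin
      (b m)
  · simpa [defectForm_apply, hb] using disk_e2
  · have swap (i : Fin 4) : curvatureTensor G y (b i) (b 3) (b 2) (b i) =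
        curvatureTensor G y (b i) (b 2) (b 3) (b i) := T.reverse _ _ _ _
    convert disk_e23 using 1 <;>
      simp only [defectForm_apply, curvatureTensor_add_middle, map_add, add_apply, hb, swap] <;>
      simp <;> ring

end IsMetricOn

end DimFour

end LocalMetric

namespace LocalMetric

section NormalCoordinates

variable {E : Type*} [NormedAddCommGroup E] [NormedSpace ℝ E]

/-- The second-order Taylor polynomial of the exponential map at `y` of a connection with
Christoffel symbols `Γ` at `y`. In the coordinates it defines, the Christoffel symbols vanish at
the origin. -/
noncomputable def expTaylor (y : E) (Γ : E →L[ℝ] E →L[ℝ] E) (x : E) : E :=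
  y + x - (1 / 2 : ℝ) • Γ x x

section ExpTaylor

variable {y : E} {Γ : E →L[ℝ] E →L[ℝ] E}

theorem expTaylor_zero : expTaylor y Γ 0 = y := by simp [expTaylor]

theorem contDiff_expTaylor : ContDiff ℝ ∞ (expTaylor y Γ) := by
  unfold expTaylor
  fun_prop

theorem fderiv_expTaylor (hΓ : ∀ u v, Γ u v = Γ v u) :
    fderiv ℝ (expTaylor y Γ) = fun x => ContinuousLinearMap.id ℝ E - Γ x := by
  ext1 x
  refine ((((hasFDerivAt_id x).const_add y).sub
    (((Γ.hasFDerivAt (x := x)).clm_apply (hasFDerivAt_id x)).const_smul (1 / 2 : ℝ))).congr_fderiv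
      ?_).fderiv
  ext u
  simp [hΓ u x, ← two_smul ℝ, smul_smul]

theorem fderiv_fderiv_expTaylor (hΓ : ∀ u v, Γ u v = Γ v u) (x : E) :
    fderiv ℝ (fderiv ℝ (expTaylor y Γ)) x = -Γ := by
  rw [fderiv_expTaylor hΓ, fderiv_const_sub, Γ.fderiv]

end ExpTaylor

variable {G G' : E → E →L[ℝ] E →L[ℝ] ℝ} {U V : Set E} {ψ : E → E} {x y : E}

theorem IsPullbackOn.gram_apply (h : IsPullbackOn G' G ψ V U) (hx : x ∈ V) (u v : E) :
    gram (G' x) u v = gram (G (ψ x)) (fderiv ℝ ψ x u) (fderiv ℝ ψ x v) := by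
  simp only [gram, h.apply_eq x hx]

variable [FiniteDimensional ℝ E]

theorem IsMetricOn.isPullbackOn_expTaylor (hG : IsMetricOn G U) :
    IsPullbackOn
      (fun x => (G (expTaylor y (christoffel G y) x)).bilinearComp
        (fderiv ℝ (expTaylor y (christoffel G y)) x) (fderiv ℝ (expTaylor y (christoffel G y)) x))
      G (expTaylor y (christoffel G y))
      (expTaylor y (christoffel G y) ⁻¹' U ∩ fderiv ℝ (expTaylor y (christoffel G y)) ⁻¹'
        Set.range ((↑) : (E ≃L[ℝ] E) → E →L[ℝ] E)) U where
  isMetricOn := hG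
  isOpen := (hG.isOpen.preimage contDiff_expTaylor.continuous).inter
    (ContinuousLinearEquiv.isOpen.preimage (contDiff_expTaylor.continuous_fderiv (by simp)))
  contDiffOn := contDiff_expTaylor.contDiffOn
  mapsTo _ hx := hx.1
  injective _ hx := by
    obtain ⟨e, he⟩ := hx.2
    exact he ▸ e.injective
  apply_eq _ _ _ _ := rfl

theorem IsMetricOn.exists_isPullbackOn_christoffel_eq_zero (hG : IsMetricOn G U) (hy : y ∈ U) :
    ∃ (G' : E → E →L[ℝ] E →L[ℝ] ℝ) (ψ : E → E) (V : Set E), IsPullbackOn G' G ψ V U ∧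
      0 ∈ V ∧ ψ 0 = y ∧ fderiv ℝ ψ 0 = ContinuousLinearMap.id ℝ E ∧ christoffel G' 0 = 0 := by
  have symm := hG.christoffel_symm hy
  have id_at_zero : fderiv ℝ (expTaylor y (christoffel G y)) 0 = ContinuousLinearMap.id ℝ E := by
    simp [fderiv_expTaylor symm]
  have pullback := hG.isPullbackOn_expTaylor (y := y)
  have zero_mem : (0 : E) ∈ expTaylor y (christoffel G y) ⁻¹' U ∩
      fderiv ℝ (expTaylor y (christoffel G y)) ⁻¹'
        Set.range ((↑) : (E ≃L[ℝ] E) → E →L[ℝ] E) :=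
    ⟨by rwa [Set.mem_preimage, expTaylor_zero], ContinuousLinearEquiv.refl ℝ E, id_at_zero.symm⟩
  refine ⟨_, _, _, pullback, zero_mem, expTaylor_zero, id_at_zero, ?_⟩
  ext u v
  have transform := pullback.fderiv_christoffel_apply zero_mem u v
  rw [fderiv_fderiv_expTaylor symm, expTaylor_zero, id_at_zero] at transform
  simpa using transform

namespace IsPullbackOn

theorem curvatureTensor_apply (h : IsPullbackOn G' G ψ V U) (hx : x ∈ V) (u v w z : E) :
    curvatureTensor G' x u v w z = curvatureTensor G (ψ x) (fderiv ℝ ψ x u) (fderiv ℝ ψ x v)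
      (fderiv ℝ ψ x w) (fderiv ℝ ψ x z) := by
  rw [curvatureTensor, h.apply_eq x hx, h.fderiv_curvature_apply hx, curvatureTensor]

theorem trace_curvature (h : IsPullbackOn G' G ψ V U) (hx : x ∈ V) (v w : E) :
    LinearMap.trace ℝ E (curvature G' x v w) =
      LinearMap.trace ℝ E (curvature G (ψ x) (fderiv ℝ ψ x v) (fderiv ℝ ψ x w)) := by
  let e : E ≃ₗ[ℝ] E := LinearEquiv.ofInjectiveEndo (fderiv ℝ ψ x).toLinearMap (h.injective x hx)
  rw [← LinearMap.trace_conj' (curvature G' x v w) e]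
  congr 1
  ext u
  rw [LinearEquiv.conj_apply_apply]
  exact (h.fderiv_curvature_apply hx _ v w).trans (congrArg _ (e.apply_symm_apply u))

end IsPullbackOn

theorem IsMetricOn.three_mul_sq_le_of_pinched (hG : IsMetricOn G U) (hy : y ∈ U)
    (hRic : ∀ x ∈ U, ∀ v w, LinearMap.trace ℝ E (curvature G x v w) = 0)
    {b : Module.Basis (Fin 4) ℝ E} (hb : ∀ i j, G y (b i) (b j) = if i = j then 1 else 0)
    {k κ : ℝ} (hk : curvatureTensor G y (b 0) (b 1) (b 1) (b 0) = k)
    (hmin : ∀ x ∈ U, ∀ u v, k * gram (G x) u v ≤ curvatureTensor G x u v v u)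
    (hmax : ∀ u v, curvatureTensor G y u v v u ≤ κ * gram (G y) u v) :
    3 * k ^ 2 ≤ 8 * (κ + k / 2) ^ 2 := by
  obtain ⟨G', ψ, V, hψ, zero_mem, ψ_zero, fderiv_zero, hΓ⟩ :=
    hG.exists_isPullbackOn_christoffel_eq_zero hy
  have metric_zero (u v : E) : G' 0 u v = G y u v := by
    simp [hψ.apply_eq 0 zero_mem, ψ_zero, fderiv_zero]
  have tensor_zero (u v w z : E) :
      curvatureTensor G' 0 u v w z = curvatureTensor G y u v w z := by
    simp [hψ.curvatureTensor_apply zero_mem, ψ_zero, fderiv_zero]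
  refine hψ.isMetricOn_pullback.three_mul_sq_le_of_christoffel_eq_zero zero_mem hΓ
    (fun x hx v w => ?_) (fun i j => ?_) ((tensor_zero _ _ _ _).trans hk)
    (fun x hx u v => ?_) fun u v => ?_
  · rw [hψ.trace_curvature hx, hRic _ (hψ.mapsTo hx)]
  · rw [metric_zero, hb]
  · rw [hψ.curvatureTensor_apply hx, hψ.gram_apply hx]
    exact hmin _ (hψ.mapsTo hx) _ _
  · simpa only [tensor_zero, gram, metric_zero] using hmax u v

end NormalCoordinates

end LocalMetric

namespace Riemannian

open LocalMetric

section Charts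

variable {E : Type*} [NormedAddCommGroup E] [NormedSpace ℝ E]
  {M : Type*} [TopologicalSpace M] [ChartedSpace E M] {p q : M} {y : E}

/-- The change of coordinates from the chart around `q` to the chart around `p`. -/
noncomputable def chartTransition (p q : M) (y : E) : E :=
  extChartAt 𝓘(ℝ, E) p ((extChartAt 𝓘(ℝ, E) q).symm y)

/-- The differential at `q` of the chart around `p`, where `T_q M` is read as `E`. -/
noncomputable def chartDeriv (p q : M) : E →L[ℝ] E :=
  mfderiv 𝓘(ℝ, E) 𝓘(ℝ, E) (extChartAt 𝓘(ℝ, E) p) q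

/-- The differential at `y` of the inverse of the chart around `p`, where the tangent space of `M`
is read as `E`. -/
noncomputable def chartSymmDeriv (p : M) (y : E) : E →L[ℝ] E :=
  mfderiv 𝓘(ℝ, E) 𝓘(ℝ, E) (extChartAt 𝓘(ℝ, E) p).symm y

theorem chartTransition_extChartAt : chartTransition p q (extChartAt 𝓘(ℝ, E) q q) =
    extChartAt 𝓘(ℝ, E) p q := by
  simp [chartTransition]

variable [IsManifold 𝓘(ℝ, E) ∞ M]

theorem chartSymmDeriv_chartDeriv (hq : q ∈ (extChartAt 𝓘(ℝ, E) p).source)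
    (v : E) :
    chartSymmDeriv p (extChartAt 𝓘(ℝ, E) p q)
      (chartDeriv p q v) = v := by
  have : IsManifold 𝓘(ℝ, E) 1 M := IsManifold.of_le (n := ∞) (by simp)
  have h := mfderivWithin_extChartAt_symm_comp_mfderiv_extChartAt' (I := 𝓘(ℝ, E)) (x := p) hq
  rw [ModelWithCorners.range_eq_univ, mfderivWithin_univ] at h
  exact DFunLike.congr_fun h v

theorem chartDeriv_chartSymmDeriv (hy : y ∈ (extChartAt 𝓘(ℝ, E) p).target)
    (v : E) :
    chartDeriv p ((extChartAt 𝓘(ℝ, E) p).symm y)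
      (chartSymmDeriv p y v) = v := by
  have : IsManifold 𝓘(ℝ, E) 1 M := IsManifold.of_le (n := ∞) (by simp)
  have h := mfderiv_extChartAt_comp_mfderivWithin_extChartAt_symm (I := 𝓘(ℝ, E)) (x := p) hy
  rw [ModelWithCorners.range_eq_univ, mfderivWithin_univ] at h
  exact DFunLike.congr_fun h v

theorem chartSymmDeriv_injective (hy : y ∈ (extChartAt 𝓘(ℝ, E) p).target) :
    Function.Injective (chartSymmDeriv p y) :=
  Function.LeftInverse.injective (chartDeriv_chartSymmDeriv hy)

theorem chartDeriv_injective (hq : q ∈ (extChartAt 𝓘(ℝ, E) p).source) :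
    Function.Injective (chartDeriv (E := E) p q) :=
  Function.LeftInverse.injective (chartSymmDeriv_chartDeriv hq)

theorem mdifferentiableAt_extChartAt_of_mem_source (hq : q ∈ (extChartAt 𝓘(ℝ, E) p).source) :
    MDifferentiableAt 𝓘(ℝ, E) 𝓘(ℝ, E) (extChartAt 𝓘(ℝ, E) p) q :=
  have : IsManifold 𝓘(ℝ, E) 1 M := IsManifold.of_le (n := ∞) (by simp)
  mdifferentiableAt_extChartAt (by simpa using hq)

theorem contDiffOn_chartTransition (p q : M) :
    ContDiffOn ℝ ∞ (chartTransition p q : E → E) ((extChartAt 𝓘(ℝ, E) q).target ∩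
      (extChartAt 𝓘(ℝ, E) q).symm ⁻¹' (extChartAt 𝓘(ℝ, E) p).source) := by
  rw [← contMDiffOn_iff_contDiffOn]
  refine (contMDiffOn_extChartAt (I := 𝓘(ℝ, E)) (n := ∞) (x := p)).comp
    ((contMDiffOn_extChartAt_symm (I := 𝓘(ℝ, E)) (n := ∞) q).mono Set.inter_subset_left)
    fun y hy => ?_
  simpa using hy.2

theorem fderiv_chartTransition (hy : y ∈ (extChartAt 𝓘(ℝ, E) q).target)
    (hp : (extChartAt 𝓘(ℝ, E) q).symm y ∈ (extChartAt 𝓘(ℝ, E) p).source) (u : E) :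
    fderiv ℝ (chartTransition p q) y u =
      chartDeriv p ((extChartAt 𝓘(ℝ, E) q).symm y)
        (chartSymmDeriv q y u) := by
  have differentiable_symm : MDifferentiableAt 𝓘(ℝ, E) 𝓘(ℝ, E) (extChartAt 𝓘(ℝ, E) q).symm y :=
    ((contMDiffOn_extChartAt_symm (I := 𝓘(ℝ, E)) (n := ∞) q).contMDiffAt
      ((isOpen_extChartAt_target q).mem_nhds hy)).mdifferentiableAt (by simp)
  have chain := mfderiv_comp y (mdifferentiableAt_extChartAt_of_mem_source hp) differentiable_symm
  rw [mfderiv_eq_fderiv] at chain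
  exact DFunLike.congr_fun chain u

theorem fderiv_chartTransition_chartDeriv (hq : q ∈ (extChartAt 𝓘(ℝ, E) p).source) (u : E) :
    fderiv ℝ (chartTransition p q) (extChartAt 𝓘(ℝ, E) q q)
        (chartDeriv q q u) =
      chartDeriv p q u := by
  rw [fderiv_chartTransition (mem_extChartAt_target q) (by simpa using hq),
    chartSymmDeriv_chartDeriv (mem_extChartAt_source q), extChartAt_to_inv]

theorem contMDiffOn_chartSymmDeriv (p : M) (v : E) :
    ContMDiffOn 𝓘(ℝ, E) (𝓘(ℝ, E).prod 𝓘(ℝ, E)) ∞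
      (fun y => (⟨(extChartAt 𝓘(ℝ, E) p).symm y,
        mfderiv 𝓘(ℝ, E) 𝓘(ℝ, E) (extChartAt 𝓘(ℝ, E) p).symm y v⟩ : TangentBundle 𝓘(ℝ, E) M))
      (extChartAt 𝓘(ℝ, E) p).target := by
  have isOpen : IsOpen (extChartAt 𝓘(ℝ, E) p).target := isOpen_extChartAt_target p
  have tangentMap := (contMDiffOn_extChartAt_symm (I := 𝓘(ℝ, E)) (n := ∞)
    p).contMDiffOn_tangentMapWithin (m := ∞) (by simp) isOpen.uniqueMDiffOn
  have const : ContMDiff 𝓘(ℝ, E) (𝓘(ℝ, E).prod 𝓘(ℝ, E)) ∞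
      (fun y : E => (⟨y, v⟩ : TangentBundle 𝓘(ℝ, E) E)) :=
    contMDiff_vectorSpace_iff_contDiff.2 contDiff_const
  refine (tangentMap.comp (const.contMDiffOn (s := (extChartAt 𝓘(ℝ, E) p).target))
    fun y hy => hy).congr fun y hy => ?_
  simp only [Function.comp, tangentMapWithin, mfderivWithin_of_isOpen isOpen hy]

theorem metricInChart_apply (g : Metric E M) (p : M) (y u v : E) :
    metricInChart g p y u v = g.inner ((extChartAt 𝓘(ℝ, E) p).symm y)
      (mfderiv 𝓘(ℝ, E) 𝓘(ℝ, E) (extChartAt 𝓘(ℝ, E) p).symm y u)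
      (mfderiv 𝓘(ℝ, E) 𝓘(ℝ, E) (extChartAt 𝓘(ℝ, E) p).symm y v) :=
  rfl

theorem contDiffOn_metricInChart_apply (g : Metric E M) (p : M) (u v : E) :
    ContDiffOn ℝ ∞ (fun y => metricInChart g p y u v) (extChartAt 𝓘(ℝ, E) p).target := by
  rw [← contMDiffOn_iff_contDiffOn]
  have smooth := ContMDiffOn.clm_bundle_apply₂ (F₁ := E) (F₂ := E) (F₃ := ℝ)
    (E₃ := fun _ : M => ℝ) (b := (extChartAt 𝓘(ℝ, E) p).symm)
    (g.contMDiff.comp_contMDiffOn (contMDiffOn_extChartAt_symm (I := 𝓘(ℝ, E)) (n := ∞) p))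
    (contMDiffOn_chartSymmDeriv p u) (contMDiffOn_chartSymmDeriv p v)
  exact fun y hy => (Bundle.contMDiffWithinAt_totalSpace.1 (smooth y hy)).2

theorem metricInChart_chartDeriv (g : Metric E M) (hq : q ∈ (extChartAt 𝓘(ℝ, E) p).source)
    (u v : E) :
    metricInChart g p (extChartAt 𝓘(ℝ, E) p q)
      (chartDeriv p q u)
      (chartDeriv p q v) =
      g.inner q (u : TangentSpace 𝓘(ℝ, E) q) (v : TangentSpace 𝓘(ℝ, E) q) := by
  have inner_congr (q' : M) (h : q' = q) (a b : E) :
      g.inner q' (a : TangentSpace 𝓘(ℝ, E) q') (b : TangentSpace 𝓘(ℝ, E) q') =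
        g.inner q (a : TangentSpace 𝓘(ℝ, E) q) (b : TangentSpace 𝓘(ℝ, E) q) := by
    subst h; rfl
  refine (inner_congr _ ((extChartAt 𝓘(ℝ, E) p).left_inv hq) _ _).trans ?_
  congr 1
  · congr 1
    exact chartSymmDeriv_chartDeriv hq u
  · exact chartSymmDeriv_chartDeriv hq v

variable [FiniteDimensional ℝ E]

theorem isMetricOn_metricInChart (g : Metric E M) (p : M) :
    IsMetricOn (metricInChart g p) (extChartAt 𝓘(ℝ, E) p).target where
  isOpen := isOpen_extChartAt_target p
  contDiffOn := contDiffOn_clm_apply.2 fun u =>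
    contDiffOn_clm_apply.2 fun v => contDiffOn_metricInChart_apply g p u v
  symm y _ u v := by rw [metricInChart_apply, metricInChart_apply, g.symm]
  pos y hy u hu := by
    rw [metricInChart_apply]
    exact g.pos _ _ fun h =>
      hu (chartSymmDeriv_injective hy (h.trans (map_zero _).symm))

theorem isPullbackOn_metricInChart (g : Metric E M) (p q : M) :
    IsPullbackOn (metricInChart g q) (metricInChart g p) (chartTransition p q)
      ((extChartAt 𝓘(ℝ, E) q).target ∩
        (extChartAt 𝓘(ℝ, E) q).symm ⁻¹' (extChartAt 𝓘(ℝ, E) p).source)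
      (extChartAt 𝓘(ℝ, E) p).target where
  isMetricOn := isMetricOn_metricInChart g p
  isOpen := (continuousOn_extChartAt_symm q).isOpen_inter_preimage (isOpen_extChartAt_target q)
    (isOpen_extChartAt_source p)
  contDiffOn := contDiffOn_chartTransition p q
  mapsTo _ hy := (extChartAt 𝓘(ℝ, E) p).map_source hy.2
  injective y hy u v h := by
    rw [fderiv_chartTransition hy.1 hy.2, fderiv_chartTransition hy.1 hy.2] at h
    exact chartSymmDeriv_injective hy.1 (chartDeriv_injective hy.2 h)
  apply_eq y hy u v := by
    rw [fderiv_chartTransition hy.1 hy.2, fderiv_chartTransition hy.1 hy.2]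
    exact (metricInChart_chartDeriv g hy.2 _ _).symm

theorem chartDeriv_curvature (g : Metric E M) (hq : q ∈ (extChartAt 𝓘(ℝ, E) p).source)
    (u v w : E) :
    chartDeriv (E := E) p q (curvature g q v w u) =
      LocalMetric.curvature (metricInChart g p) (extChartAt 𝓘(ℝ, E) p q) (chartDeriv p q v)
        (chartDeriv p q w) (chartDeriv p q u) := by
  have : IsManifold 𝓘(ℝ, E) 1 M := IsManifold.of_le (n := ∞) (by simp)
  have invertible : (chartDeriv (E := E) q q).IsInvertible :=
    isInvertible_mfderiv_extChartAt (mem_extChartAt_source q)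
  have mem : extChartAt 𝓘(ℝ, E) q q ∈ (extChartAt 𝓘(ℝ, E) q).target ∩
      (extChartAt 𝓘(ℝ, E) q).symm ⁻¹' (extChartAt 𝓘(ℝ, E) p).source :=
    ⟨mem_extChartAt_target q, by simpa using hq⟩
  have naturality := (isPullbackOn_metricInChart g p q).fderiv_curvature_apply mem
    (chartDeriv q q u) (chartDeriv q q v) (chartDeriv q q w)
  rw [fderiv_chartTransition_chartDeriv hq, fderiv_chartTransition_chartDeriv hq,
    fderiv_chartTransition_chartDeriv hq, chartTransition_extChartAt] at naturality
  exact ((fderiv_chartTransition_chartDeriv hq _).symm.trans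
    (congrArg _ (invertible.self_apply_inverse _))).trans naturality

/-- The differential at `q` of the chart around `p` as a linear isomorphism. -/
noncomputable def tangentEquiv (hq : q ∈ (extChartAt 𝓘(ℝ, E) p).source) :
    TangentSpace 𝓘(ℝ, E) q ≃ₗ[ℝ] E :=
  let L : E ≃ₗ[ℝ] E :=
    LinearEquiv.ofInjectiveEndo (chartDeriv p q).toLinearMap (chartDeriv_injective hq)
  L

theorem metricInChart_tangentEquiv (g : Metric E M) (hq : q ∈ (extChartAt 𝓘(ℝ, E) p).source)
    (u v : TangentSpace 𝓘(ℝ, E) q) :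
    metricInChart g p (extChartAt 𝓘(ℝ, E) p q) (tangentEquiv hq u) (tangentEquiv hq v) =
      g.inner q u v :=
  metricInChart_chartDeriv g hq u v

theorem tangentEquiv_curvature (g : Metric E M) (hq : q ∈ (extChartAt 𝓘(ℝ, E) p).source)
    (u v w : TangentSpace 𝓘(ℝ, E) q) :
    tangentEquiv hq (curvature g q v w u) =
      LocalMetric.curvature (metricInChart g p) (extChartAt 𝓘(ℝ, E) p q) (tangentEquiv hq v)
        (tangentEquiv hq w) (tangentEquiv hq u) :=
  chartDeriv_curvature g hq u v w

end Charts

end Riemannian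

namespace LocalMetric

section OrthonormalPairs

variable {E : Type*} [NormedAddCommGroup E] [NormedSpace ℝ E]

/-- The vectors `u`, `v` form an orthonormal pair for the symmetric bilinear form `B`. -/
structure IsOrthonormalPair (B : E →L[ℝ] E →L[ℝ] ℝ) (u v : E) : Prop where
  left : B u u = 1
  right : B v v = 1
  orthogonal : B u v = 0

variable {B : E →L[ℝ] E →L[ℝ] ℝ} {u v : E}

theorem IsOrthonormalPair.gram_eq_one (h : IsOrthonormalPair B u v) : gram B u v = 1 := by
  simp [gram, h.left, h.right, h.orthogonal]

theorem IsOrthonormalPair.linearIndependent (h : IsOrthonormalPair B u v) :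
    LinearIndependent ℝ ![u, v] := by
  rw [LinearIndependent.pair_iff]
  intro s t hst
  have left := congrArg (B u) hst
  have right := congrArg (fun x => B x v) hst
  simp only [map_add, map_smul, add_apply, smul_apply, smul_eq_mul, h.left, h.right,
    h.orthogonal, map_zero, zero_apply] at left right
  constructor <;> linarith

theorem exists_smul_eq_and_apply_eq_one (pos : ∀ u, u ≠ 0 → 0 < B u u) (hu : u ≠ 0) :
    ∃ (a : ℝ) (u' : E), a ≠ 0 ∧ B u' u' = 1 ∧ u = a • u' := by
  have norm_ne_zero : √(B u u) ≠ 0 := (Real.sqrt_pos.2 (pos u hu)).ne'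
  refine ⟨√(B u u), (√(B u u))⁻¹ • u, norm_ne_zero, ?_, (smul_inv_smul₀ norm_ne_zero u).symm⟩
  simp only [map_smul, smul_apply, smul_eq_mul]
  rw [← mul_assoc, ← mul_inv, Real.mul_self_sqrt (pos u hu).le, inv_mul_cancel₀ (pos u hu).ne']

theorem exists_isOrthonormalPair (pos : ∀ u, u ≠ 0 → 0 < B u u)
    (h : LinearIndependent ℝ ![u, v]) :
    ∃ (u' v' : E) (a b c : ℝ), IsOrthonormalPair B u' v' ∧ a ≠ 0 ∧ c ≠ 0 ∧
      u = a • u' ∧ v = b • u' + c • v' := by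
  obtain ⟨a, u', ha, hu', rfl⟩ := exists_smul_eq_and_apply_eq_one pos (h.ne_zero 0)
  have residual_ne_zero : v - B u' v • u' ≠ 0 := by
    intro h0
    refine one_ne_zero (LinearIndependent.pair_iff.1 h (-(B u' v * a⁻¹)) 1 ?_).2
    rw [smul_smul, neg_mul, inv_mul_cancel_right₀ ha, one_smul, neg_smul, neg_add_eq_sub, h0]
  obtain ⟨c, v', hc, hv', hv⟩ := exists_smul_eq_and_apply_eq_one pos residual_ne_zero
  have orthogonal : c * B u' v' = 0 := by
    rw [← smul_eq_mul, ← map_smul, ← hv]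
    simp [hu']
  exact ⟨u', v', a, B u' v, c, ⟨hu', hv', (mul_eq_zero.1 orthogonal).resolve_left hc⟩, ha, hc,
    rfl, by rw [← hv]; abel⟩

end OrthonormalPairs

theorem exists_orthonormal_basis_extending_pair {V : Type*} [AddCommGroup V] [Module ℝ V]
    [FiniteDimensional ℝ V] {n : ℕ} (hV : Module.finrank ℝ V = n + 2)
    {B : LinearMap.BilinForm ℝ V} (symm : ∀ u v, B u v = B v u) (pos : ∀ u, u ≠ 0 → 0 < B u u)
    {u v : V} (hu : B u u = 1) (hv : B v v = 1) (huv : B u v = 0) :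
    ∃ b : Module.Basis (Fin (n + 2)) ℝ V,
      (∀ i j, B (b i) (b j) = if i = j then 1 else 0) ∧ b 0 = u ∧ b 1 = v := by
  let core : InnerProductSpace.Core ℝ V :=
    { inner := fun x y => B x y
      conj_inner_symm := fun x y => symm y x
      re_inner_nonneg := fun x => by
        rcases eq_or_ne x 0 with rfl | hx
        · simp
        · exact (pos x hx).le
      add_left := fun x y z => by simp
      smul_left := fun x y r => by simp
      definite := fun x hx => by
        by_contra h0
        exact (pos x h0).ne' hx }
  let _ : NormedAddCommGroup V := core.toNormedAddCommGroup
  let _ : InnerProductSpace ℝ V := InnerProductSpace.ofCore core.toCore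
  have orthonormal : Orthonormal ℝ
      (Set.domRestrict ({0, 1} : Set (Fin (n + 2))) fun i => if i = 0 then u else v) := by
    rw [orthonormal_iff_ite]
    rintro ⟨i, rfl | rfl⟩ ⟨j, rfl | rfl⟩ <;> change B _ _ = _ <;>
      simp [Set.domRestrict, Subtype.ext_iff, hu, hv, huv, symm v u]
  obtain ⟨b, hb⟩ := orthonormal.exists_orthonormalBasis_extension_of_card_eq (by simp [hV])
  refine ⟨b.toBasis, fun i j => ?_, ?_, ?_⟩
  · rw [b.coe_toBasis]
    exact orthonormal_iff_ite.1 b.orthonormal i j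
  · simpa using hb 0 (by simp)
  · simpa using hb 1 (by simp)

section Planes

variable {E : Type*} [NormedAddCommGroup E] [NormedSpace ℝ E]
  {G : E → E →L[ℝ] E →L[ℝ] ℝ} {U : Set E} {y u v : E}

theorem IsOrthonormalPair.exists_basis [FiniteDimensional ℝ E] {n : ℕ}
    (hE : Module.finrank ℝ E = n + 2) (hG : IsMetricOn G U) (hy : y ∈ U)
    (h : IsOrthonormalPair (G y) u v) :
    ∃ b : Module.Basis (Fin (n + 2)) ℝ E,
      (∀ i j, G y (b i) (b j) = if i = j then 1 else 0) ∧ b 0 = u ∧ b 1 = v :=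
  exists_orthonormal_basis_extending_pair (B := (G y).toBilinForm) hE (hG.symm y hy)
    (hG.pos y hy) h.left h.right h.orthogonal

theorem IsMetricOn.exists_isOrthonormalPair_of_two_le_finrank (hG : IsMetricOn G U)
    (hy : y ∈ U) (hE : 2 ≤ Module.finrank ℝ E) : ∃ u v, IsOrthonormalPair (G y) u v := by
  obtain ⟨f, hf⟩ := exists_linearIndependent_of_le_finrank hE
  have independent : LinearIndependent ℝ ![f 0, f 1] := by
    rwa [← FinVec.etaExpand_eq f] at hf
  obtain ⟨u, v, -, -, -, huv, -⟩ := exists_isOrthonormalPair (hG.pos y hy) independent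
  exact ⟨u, v, huv⟩

theorem gram_combination (B : E →L[ℝ] E →L[ℝ] ℝ) (symm : B u v = B v u) (a b c : ℝ) :
    gram B (a • u) (b • u + c • v) = a ^ 2 * c ^ 2 * gram B u v := by
  simp only [gram, map_add, map_smul, add_apply, smul_apply, smul_eq_mul, ← symm]
  ring

variable [FiniteDimensional ℝ E]

theorem curvatureTensor_smul (a b c d : ℝ) (w z : E) :
    curvatureTensor G y (a • u) (b • v) (c • w) (d • z) =
      a * b * c * d * curvatureTensor G y u v w z := by
  simp only [curvatureTensor, curvature_apply, map_smul, smul_apply, ← smul_sub, ← smul_add,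
    smul_eq_mul]
  ring

namespace IsMetricOn

theorem curvatureTensor_combination (hG : IsMetricOn G U) (hy : y ∈ U) (a b c : ℝ) :
    curvatureTensor G y (a • u) (b • u + c • v) (b • u + c • v) (a • u) =
      a ^ 2 * c ^ 2 * curvatureTensor G y u v v u := by
  have T := hG.isCurvatureTensor hy
  simp only [curvatureTensor_add_middle, curvatureTensor_smul, T.self_left, T.self_right]
  ring

theorem exists_isOrthonormalPair_curvatureTensor_eq (hG : IsMetricOn G U) (hy : y ∈ U)
    (h : LinearIndependent ℝ ![u, v]) :
    ∃ u' v', IsOrthonormalPair (G y) u' v' ∧ 0 < gram (G y) u v ∧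
      curvatureTensor G y u v v u = gram (G y) u v * curvatureTensor G y u' v' v' u' := by
  obtain ⟨u', v', a, b, c, hpair, ha, hc, rfl, rfl⟩ := exists_isOrthonormalPair (hG.pos y hy) h
  rw [gram_combination (G y) (hG.symm y hy _ _), hpair.gram_eq_one, mul_one,
    hG.curvatureTensor_combination hy]
  exact ⟨u', v', hpair, by positivity, rfl⟩

theorem curvatureTensor_and_gram_eq_zero (hG : IsMetricOn G U) (hy : y ∈ U)
    (h : ¬LinearIndependent ℝ ![u, v]) :
    curvatureTensor G y u v v u = 0 ∧ gram (G y) u v = 0 := by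
  rcases eq_or_ne u 0 with rfl | hu
  · simp [curvatureTensor, gram]
  · rw [LinearIndependent.pair_iff' hu] at h
    push Not at h
    obtain ⟨a, rfl⟩ := h
    constructor
    · simpa using hG.curvatureTensor_combination (u := u) (v := 0) hy 1 a 0
    · simpa using gram_combination (u := u) (v := 0) (G y) (by simp) 1 a 0

theorem mul_gram_le_curvatureTensor (hG : IsMetricOn G U) (hy : y ∈ U) {k : ℝ}
    (h : ∀ u v, IsOrthonormalPair (G y) u v → k ≤ curvatureTensor G y u v v u) (u v : E) :
    k * gram (G y) u v ≤ curvatureTensor G y u v v u := by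
  by_cases hi : LinearIndependent ℝ ![u, v]
  · obtain ⟨u', v', hpair, hpos, eq⟩ := hG.exists_isOrthonormalPair_curvatureTensor_eq hy hi
    rw [eq, mul_comm]
    exact mul_le_mul_of_nonneg_left (h u' v' hpair) hpos.le
  · simp [hG.curvatureTensor_and_gram_eq_zero hy hi]

theorem curvatureTensor_le_mul_gram (hG : IsMetricOn G U) (hy : y ∈ U) {k : ℝ}
    (h : ∀ u v, IsOrthonormalPair (G y) u v → curvatureTensor G y u v v u ≤ k) (u v : E) :
    curvatureTensor G y u v v u ≤ k * gram (G y) u v := by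
  by_cases hi : LinearIndependent ℝ ![u, v]
  · obtain ⟨u', v', hpair, hpos, eq⟩ := hG.exists_isOrthonormalPair_curvatureTensor_eq hy hi
    rw [eq, mul_comm k]
    exact mul_le_mul_of_nonneg_left (h u' v' hpair) hpos.le
  · simp [hG.curvatureTensor_and_gram_eq_zero hy hi]

theorem curvature_eq_zero_of_forall_isOrthonormalPair (hG : IsMetricOn G U) (hy : y ∈ U)
    (h : ∀ u v, IsOrthonormalPair (G y) u v → curvatureTensor G y u v v u = 0) (u v w : E) :
    curvature G y v w u = 0 := by
  have T := hG.isCurvatureTensor hy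
  have nonpos (u w : E) : curvatureTensor G y u w w u ≤ 0 * gram (G y) u w :=
    hG.curvatureTensor_le_mul_gram hy (fun u v huv => (h u v huv).le) u w
  have nonneg (u w : E) : 0 * gram (G y) u w ≤ curvatureTensor G y u w w u :=
    hG.mul_gram_le_curvatureTensor hy (fun u v huv => (h u v huv).ge) u w
  have quadratic (u w v : E) : curvatureTensor G y u w w v = 0 := by
    have cauchy := hG.defectForm_sq_le hy (nonpos · w) u v
    have self_zero := (nonpos u w).antisymm (nonneg u w)
    simp only [defectForm_apply, zero_mul, zero_sub] at cauchy self_zero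
    rw [self_zero, neg_zero, zero_mul, neg_sq] at cauchy
    exact pow_eq_zero_iff two_ne_zero |>.1 (cauchy.antisymm (sq_nonneg _))
  have skew_middle (u v w z : E) : curvatureTensor G y u v w z = -curvatureTensor G y u w v z := by
    have polarized := quadratic u (v + w) z
    rw [curvatureTensor_add_middle, quadratic, quadratic] at polarized
    linarith
  refine hG.ext_of_apply hy fun z => ?_
  rw [map_zero, zero_apply]
  change curvatureTensor G y u v w z = 0
  linarith [T.bianchi u v w z, skew_middle v w u z, T.antisymm v u w z, T.antisymm w u v z,
    skew_middle u w v z]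

end IsMetricOn

end Planes

section Compactness

variable {E : Type*} [NormedAddCommGroup E] [NormedSpace ℝ E] [FiniteDimensional ℝ E]
  {G : E → E →L[ℝ] E →L[ℝ] ℝ} {U : Set E} {C : Set E}

namespace IsMetricOn

theorem continuousOn_curvatureTensor (hG : IsMetricOn G U) :
    ContinuousOn (fun x : E × E × E => curvatureTensor G x.1 x.2.1 x.2.2 x.2.2 x.2.1)
      (U ×ˢ Set.univ) := by
  have maps : Set.MapsTo (fun x : E × E × E => x.1) (U ×ˢ Set.univ) U := fun x hx => hx.1
  have cu : ContinuousOn (fun x : E × E × E => x.2.1) (U ×ˢ Set.univ) := by fun_prop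
  have cv : ContinuousOn (fun x : E × E × E => x.2.2) (U ×ˢ Set.univ) := by fun_prop
  have cG : ContinuousOn (fun x : E × E × E => G x.1) (U ×ˢ Set.univ) :=
    hG.contDiffOn.continuousOn.comp continuousOn_fst maps
  have cΓ : ContinuousOn (fun x : E × E × E => christoffel G x.1) (U ×ˢ Set.univ) :=
    hG.contDiffOn_christoffel.continuousOn.comp continuousOn_fst maps
  have cDΓ : ContinuousOn (fun x : E × E × E => fderiv ℝ (christoffel G) x.1) (U ×ˢ Set.univ) :=
    (hG.contDiffOn_christoffel.fderiv_of_isOpen (m := ∞) hG.isOpen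
      (by simp)).continuousOn.comp continuousOn_fst maps
  have cR : ContinuousOn (fun x : E × E × E => curvature G x.1 x.2.2 x.2.2 x.2.1)
      (U ×ˢ Set.univ) := by
    simp only [curvature_apply]
    exact (((((cDΓ.clm_apply cu).clm_apply cv).clm_apply cv).sub
      (((cDΓ.clm_apply cv).clm_apply cu).clm_apply cv)).add
      ((cΓ.clm_apply cu).clm_apply ((cΓ.clm_apply cv).clm_apply cv))).sub
      ((cΓ.clm_apply cv).clm_apply ((cΓ.clm_apply cu).clm_apply cv))
  exact (cG.clm_apply cR).clm_apply cu

theorem exists_forall_norm_le (hG : IsMetricOn G U) (hC : IsCompact C) (hCU : C ⊆ U) :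
    ∃ r, ∀ y ∈ C, ∀ u, G y u u = 1 → ‖u‖ ≤ r := by
  have cG : ContinuousOn (fun x : E × E => G x.1) (C ×ˢ Metric.sphere 0 1) :=
    hG.contDiffOn.continuousOn.comp continuousOn_fst fun x hx => hCU hx.1
  have cquad : ContinuousOn (fun x : E × E => G x.1 x.2 x.2) (C ×ˢ Metric.sphere 0 1) :=
    (cG.clm_apply continuousOn_snd).clm_apply continuousOn_snd
  obtain ⟨m, hm, hle⟩ := (hC.prod (isCompact_sphere (0 : E) 1)).exists_forall_le' cquad
    (a := 0) fun x hx => hG.pos _ (hCU hx.1) _ (ne_zero_of_mem_unit_sphere ⟨x.2, hx.2⟩)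
  refine ⟨√m⁻¹, fun y hy u hu => Real.le_sqrt_of_sq_le ?_⟩
  have hu0 : u ≠ 0 := by
    rintro rfl
    simp at hu
  have bound := hle (y, ‖u‖⁻¹ • u) ⟨hy, by simp [norm_smul, hu0]⟩
  simp only [map_smul, smul_apply, smul_eq_mul, hu, mul_one] at bound
  rwa [← mul_inv, ← sq, le_inv_comm₀ hm (by positivity)] at bound

theorem isCompact_orthonormalPairs (hG : IsMetricOn G U) (hC : IsCompact C) (hCU : C ⊆ U) :
    IsCompact {x : E × E × E | x.1 ∈ C ∧ IsOrthonormalPair (G x.1) x.2.1 x.2.2} := by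
  obtain ⟨r, hr⟩ := hG.exists_forall_norm_le hC hCU
  let K : Set (E × E × E) := C ×ˢ Metric.closedBall 0 r ×ˢ Metric.closedBall 0 r
  have hK : IsCompact K := hC.prod ((isCompact_closedBall 0 r).prod (isCompact_closedBall 0 r))
  have cG : ContinuousOn (fun x : E × E × E => G x.1) K :=
    hG.contDiffOn.continuousOn.comp continuousOn_fst fun x hx => hCU hx.1
  have cu : ContinuousOn (fun x : E × E × E => x.2.1) K := by fun_prop
  have cv : ContinuousOn (fun x : E × E × E => x.2.2) K := by fun_prop
  have cpairing : ContinuousOn (fun x : E × E × E =>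
      (G x.1 x.2.1 x.2.1, G x.1 x.2.2 x.2.2, G x.1 x.2.1 x.2.2)) K :=
    ((cG.clm_apply cu).clm_apply cu).prodMk
      (((cG.clm_apply cv).clm_apply cv).prodMk ((cG.clm_apply cu).clm_apply cv))
  convert hK.of_isClosed_subset
    (cpairing.preimage_isClosed_of_isClosed hK.isClosed (isClosed_singleton (x := (1, 1, 0))))
    Set.inter_subset_left using 1
  ext ⟨y, u, v⟩
  simp only [Set.mem_ofPred_eq, Set.mem_inter_iff, Set.mem_preimage, Set.mem_singleton_iff,
    Prod.mk.injEq, K, Set.mem_prod, mem_closedBall_zero_iff]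
  exact ⟨fun ⟨hy, h⟩ => ⟨⟨hy, hr y hy u h.left, hr y hy v h.right⟩, h.left, h.right, h.orthogonal⟩,
    fun ⟨hy, hu, hv, huv⟩ => ⟨hy.1, hu, hv, huv⟩⟩

theorem continuousOn_curvatureTensor_orthonormalPairs (hG : IsMetricOn G U) (hCU : C ⊆ U) :
    ContinuousOn (fun x : E × E × E => curvatureTensor G x.1 x.2.1 x.2.2 x.2.2 x.2.1)
      {x | x.1 ∈ C ∧ IsOrthonormalPair (G x.1) x.2.1 x.2.2} :=
  hG.continuousOn_curvatureTensor.mono fun _ hx => ⟨hCU hx.1, trivial⟩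

theorem exists_forall_curvatureTensor_le (hG : IsMetricOn G U) {y : E} (hy : y ∈ U) :
    ∃ κ, ∀ u v, IsOrthonormalPair (G y) u v → curvatureTensor G y u v v u ≤ κ := by
  have hyU : {y} ⊆ U := Set.singleton_subset_iff.2 hy
  obtain ⟨κ, hκ⟩ := (hG.isCompact_orthonormalPairs isCompact_singleton hyU).bddAbove_image
    (hG.continuousOn_curvatureTensor_orthonormalPairs hyU)
  exact ⟨κ, fun u v h => hκ ⟨(y, u, v), ⟨rfl, h⟩, rfl⟩⟩

theorem exists_forall_le_curvatureTensor (hG : IsMetricOn G U) (hC : IsCompact C) (hCU : C ⊆ U)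
    (hne : C.Nonempty) (hE : 2 ≤ Module.finrank ℝ E) :
    ∃ y₀ ∈ C, ∃ u₀ v₀, IsOrthonormalPair (G y₀) u₀ v₀ ∧ ∀ y ∈ C, ∀ u v,
      IsOrthonormalPair (G y) u v →
        curvatureTensor G y₀ u₀ v₀ v₀ u₀ ≤ curvatureTensor G y u v v u := by
  obtain ⟨y, hy⟩ := hne
  obtain ⟨u, v, huv⟩ := hG.exists_isOrthonormalPair_of_two_le_finrank (hCU hy) hE
  obtain ⟨⟨y₀, u₀, v₀⟩, ⟨hy₀, h₀⟩, hmin⟩ := (hG.isCompact_orthonormalPairs hC hCU).exists_isMinOn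
    ⟨(y, u, v), hy, huv⟩ (hG.continuousOn_curvatureTensor_orthonormalPairs hCU)
  exact ⟨y₀, hy₀, u₀, v₀, h₀, fun y hy u v huv => hmin (a := (y, u, v)) ⟨hy, huv⟩⟩

end IsMetricOn

end Compactness

end LocalMetric

namespace Riemannian

open LocalMetric

section SectionalCurvatures

variable {E : Type*} [NormedAddCommGroup E] [NormedSpace ℝ E] [FiniteDimensional ℝ E]
  {M : Type*} [TopologicalSpace M] [ChartedSpace E M] [IsManifold 𝓘(ℝ, E) ∞ M]
  {g : Metric E M} {p q : M} {k : ℝ}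

theorem sectionalCurvature_eq_div (g : Metric E M) (hq : q ∈ (extChartAt 𝓘(ℝ, E) p).source)
    (u v : TangentSpace 𝓘(ℝ, E) q) :
    sectionalCurvature g q u v =
      curvatureTensor (metricInChart g p) (extChartAt 𝓘(ℝ, E) p q) (tangentEquiv hq u)
        (tangentEquiv hq v) (tangentEquiv hq v) (tangentEquiv hq u) /
      gram (metricInChart g p (extChartAt 𝓘(ℝ, E) p q)) (tangentEquiv hq u)
        (tangentEquiv hq v) := by
  rw [curvatureTensor, ← tangentEquiv_curvature g, gram]
  simp only [metricInChart_tangentEquiv]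
  rfl

theorem mem_sectionalCurvatures_iff (hq : q ∈ (extChartAt 𝓘(ℝ, E) p).source) :
    k ∈ sectionalCurvatures g q ↔
      ∃ u v : E, IsOrthonormalPair (metricInChart g p (extChartAt 𝓘(ℝ, E) p q)) u v ∧
        curvatureTensor (metricInChart g p) (extChartAt 𝓘(ℝ, E) p q) u v v u = k := by
  have hG := isMetricOn_metricInChart g p
  have hy := (extChartAt 𝓘(ℝ, E) p).map_source hq
  constructor
  · rintro ⟨u, v, independent, rfl⟩
    have image_independent : LinearIndependent ℝ ![tangentEquiv hq u, tangentEquiv hq v] := by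
      simpa [LinearIndependent.pair_iff, ← map_smul, ← map_add] using independent
    obtain ⟨u', v', hpair, hpos, eq⟩ :=
      hG.exists_isOrthonormalPair_curvatureTensor_eq hy image_independent
    exact ⟨u', v', hpair,
      by rw [sectionalCurvature_eq_div g hq, eq, mul_div_cancel_left₀ _ hpos.ne']⟩
  · rintro ⟨u, v, hpair, rfl⟩
    obtain ⟨u, rfl⟩ := (tangentEquiv hq).surjective u
    obtain ⟨v, rfl⟩ := (tangentEquiv hq).surjective v
    have independent : LinearIndependent ℝ ![u, v] := by
      simpa [LinearIndependent.pair_iff, ← map_smul, ← map_add] using hpair.linearIndependent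
    exact ⟨u, v, independent, by rw [sectionalCurvature_eq_div g hq, hpair.gram_eq_one, div_one]⟩

theorem curvatureTensor_mem_sectionalCurvatures {y u v : E}
    (hy : y ∈ (extChartAt 𝓘(ℝ, E) p).target) (h : IsOrthonormalPair (metricInChart g p y) u v) :
    curvatureTensor (metricInChart g p) y u v v u ∈
      sectionalCurvatures g ((extChartAt 𝓘(ℝ, E) p).symm y) := by
  refine (mem_sectionalCurvatures_iff ((extChartAt 𝓘(ℝ, E) p).map_target hy)).2 ?_
  rw [(extChartAt 𝓘(ℝ, E) p).right_inv hy]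
  exact ⟨u, v, h, rfl⟩

theorem bddAbove_sectionalCurvatures (g : Metric E M) (p : M) :
    BddAbove (sectionalCurvatures g p) := by
  obtain ⟨κ, hκ⟩ :=
    (isMetricOn_metricInChart g p).exists_forall_curvatureTensor_le (mem_extChartAt_target p)
  refine ⟨κ, fun k hk => ?_⟩
  obtain ⟨u, v, hpair, rfl⟩ := (mem_sectionalCurvatures_iff (mem_extChartAt_source p)).1 hk
  exact hκ u v hpair

theorem nonempty_sectionalCurvatures (hE : 2 ≤ Module.finrank ℝ E) (g : Metric E M) (p : M) :
    (sectionalCurvatures g p).Nonempty := by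
  obtain ⟨u, v, hpair⟩ := (isMetricOn_metricInChart g p).exists_isOrthonormalPair_of_two_le_finrank
    (mem_extChartAt_target p) hE
  exact ⟨_, (mem_sectionalCurvatures_iff (mem_extChartAt_source p)).2 ⟨u, v, hpair, rfl⟩⟩

theorem exists_mem_nhds_forall_le_sectionalCurvatures (hE : 2 ≤ Module.finrank ℝ E)
    (g : Metric E M) (p : M) :
    ∃ W ∈ nhds p, ∃ k, (∃ q, k ∈ sectionalCurvatures g q) ∧
      ∀ q ∈ W, ∀ k' ∈ sectionalCurvatures g q, k ≤ k' := by
  have hG := isMetricOn_metricInChart g p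
  obtain ⟨C, hC, hpC, hCU⟩ := exists_compact_subset hG.isOpen (mem_extChartAt_target p)
  obtain ⟨y, hy, u, v, hpair, hmin⟩ :=
    hG.exists_forall_le_curvatureTensor hC hCU ⟨_, interior_subset hpC⟩ hE
  refine ⟨(extChartAt 𝓘(ℝ, E) p).source ∩ extChartAt 𝓘(ℝ, E) p ⁻¹' interior C,
    Filter.inter_mem (extChartAt_source_mem_nhds p)
      ((continuousAt_extChartAt p).preimage_mem_nhds (isOpen_interior.mem_nhds hpC)),
    _, ⟨_, curvatureTensor_mem_sectionalCurvatures (hCU hy) hpair⟩, ?_⟩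
  rintro q ⟨hq, hqC⟩ k' hk'
  obtain ⟨u', v', hpair', rfl⟩ := (mem_sectionalCurvatures_iff hq).1 hk'
  exact hmin _ (interior_subset hqC) u' v' hpair'

theorem exists_forall_le_sectionalCurvatures [CompactSpace M] [Nonempty M]
    (hE : 2 ≤ Module.finrank ℝ E) (g : Metric E M) :
    ∃ (q : M) (k : ℝ), k ∈ sectionalCurvatures g q ∧
      ∀ p, ∀ k' ∈ sectionalCurvatures g p, k ≤ k' := by
  choose W hW k hk hmin using exists_mem_nhds_forall_le_sectionalCurvatures hE g
  obtain ⟨t, ht⟩ := isCompact_univ.elim_nhds_subcover W fun p _ => hW p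
  have cover (x : M) : ∃ p ∈ t, x ∈ W p := by simpa using ht.2 (Set.mem_univ x)
  obtain ⟨p, -, hp⟩ := t.exists_min_image k ((cover (Classical.arbitrary M)).imp fun _ h => h.1)
  obtain ⟨q, hq⟩ := hk p
  refine ⟨q, k p, hq, fun x k' hk' => ?_⟩
  obtain ⟨p', hp', hx⟩ := cover x
  exact (hp p' hp').trans (hmin p' x hx k' hk')

theorem isFlat_of_forall_sectionalCurvatures_eq_zero
    (h : ∀ p, ∀ k ∈ sectionalCurvatures g p, k = 0) : IsFlat g := by
  intro p u v w
  have hp := mem_extChartAt_source (I := 𝓘(ℝ, E)) p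
  apply (tangentEquiv hp).injective
  rw [map_zero, tangentEquiv_curvature g hp]
  exact (isMetricOn_metricInChart g p).curvature_eq_zero_of_forall_isOrthonormalPair
    (mem_extChartAt_target p)
    (fun u v hpair => h p _ ((mem_sectionalCurvatures_iff hp).2 ⟨u, v, hpair, rfl⟩)) _ _ _

theorem trace_curvature_metricInChart (hRic : IsRicciFlat g) {y : E}
    (hy : y ∈ (extChartAt 𝓘(ℝ, E) p).target) (v w : E) :
    LinearMap.trace ℝ E (LocalMetric.curvature (metricInChart g p) y v w) = 0 := by
  obtain ⟨q, hq, rfl⟩ : ∃ q ∈ (extChartAt 𝓘(ℝ, E) p).source, extChartAt 𝓘(ℝ, E) p q = y :=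
    ⟨_, (extChartAt 𝓘(ℝ, E) p).map_target hy, (extChartAt 𝓘(ℝ, E) p).right_inv hy⟩
  obtain ⟨v, rfl⟩ := (tangentEquiv hq).surjective v
  obtain ⟨w, rfl⟩ := (tangentEquiv hq).surjective w
  rw [← hRic q v w, ricci, ← LinearMap.trace_conj' (curvature g q v w) (tangentEquiv hq)]
  congr 1
  ext u
  rw [LinearEquiv.conj_apply_apply, tangentEquiv_curvature, LinearEquiv.apply_symm_apply]

end SectionalCurvatures

section DimFour

variable {E : Type*} [NormedAddCommGroup E] [NormedSpace ℝ E] [FiniteDimensional ℝ E]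
  {M : Type*} [TopologicalSpace M] [ChartedSpace E M] [IsManifold 𝓘(ℝ, E) ∞ M]
  {g : Metric E M} {q : M} {k κ : ℝ}

theorem exists_basis_curvatureTensor_eq (hE : Module.finrank ℝ E = 4)
    (hk : k ∈ sectionalCurvatures g q) :
    ∃ b : Module.Basis (Fin 4) ℝ E,
      (∀ i j, metricInChart g q (extChartAt 𝓘(ℝ, E) q q) (b i) (b j) = if i = j then 1 else 0) ∧
      curvatureTensor (metricInChart g q) (extChartAt 𝓘(ℝ, E) q q) (b 0) (b 1) (b 1) (b 0) =
        k := by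
  obtain ⟨u, v, hpair, rfl⟩ := (mem_sectionalCurvatures_iff (mem_extChartAt_source q)).1 hk
  obtain ⟨b, hb, rfl, rfl⟩ :=
    hpair.exists_basis (n := 2) hE (isMetricOn_metricInChart g q) (mem_extChartAt_target q)
  exact ⟨b, hb, rfl⟩

theorem three_mul_sq_le_of_forall_le (hE : Module.finrank ℝ E = 4) (hRic : IsRicciFlat g)
    (hk : k ∈ sectionalCurvatures g q) (hmin : ∀ p, ∀ k' ∈ sectionalCurvatures g p, k ≤ k')
    (hmax : ∀ k' ∈ sectionalCurvatures g q, k' ≤ κ) : 3 * k ^ 2 ≤ 8 * (κ + k / 2) ^ 2 := by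
  have hG := isMetricOn_metricInChart g q
  have hy := mem_extChartAt_target (I := 𝓘(ℝ, E)) q
  obtain ⟨b, hb, hbk⟩ := exists_basis_curvatureTensor_eq hE hk
  exact hG.three_mul_sq_le_of_pinched hy (fun x hx => trace_curvature_metricInChart hRic hx) hb hbk
    (fun x hx => hG.mul_gram_le_curvatureTensor hx fun u v hpair =>
      hmin _ _ (curvatureTensor_mem_sectionalCurvatures hx hpair))
    (hG.curvatureTensor_le_mul_gram hy fun u v hpair =>
      hmax _ ((mem_sectionalCurvatures_iff (mem_extChartAt_source q)).2 ⟨u, v, hpair, rfl⟩))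

theorem exists_mem_sectionalCurvatures_add_eq_neg (hE : Module.finrank ℝ E = 4)
    (hRic : IsRicciFlat g) (hk : k ∈ sectionalCurvatures g q) :
    ∃ k₁ ∈ sectionalCurvatures g q, ∃ k₂ ∈ sectionalCurvatures g q, k₁ + k₂ = -k := by
  have hy := mem_extChartAt_target (I := 𝓘(ℝ, E)) q
  obtain ⟨b, hb, rfl⟩ := exists_basis_curvatureTensor_eq hE hk
  have hpair {i j : Fin 4} (hij : i ≠ j) :
      IsOrthonormalPair (metricInChart g q (extChartAt 𝓘(ℝ, E) q q)) (b i) (b j) :=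
    ⟨(hb i i).trans (if_pos rfl), (hb j j).trans (if_pos rfl), (hb i j).trans (if_neg hij)⟩
  have mem {j : Fin 4} (hj : 0 ≠ j) := (mem_sectionalCurvatures_iff (g := g)
    (mem_extChartAt_source q)).2 ⟨_, _, hpair hj, rfl⟩
  have weyl := (isMetricOn_metricInChart g q).isWeylTensor hy hb
    (trace_curvature_metricInChart hRic hy)
  refine ⟨_, mem (j := 2) (by decide), _, mem (j := 3) (by decide), ?_⟩
  linarith [weyl.apply_0330]

theorem isFlat_of_sectionalCurvatures_nonneg (hE : Module.finrank ℝ E = 4) (hRic : IsRicciFlat g)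
    (h : ∀ p, ∀ k ∈ sectionalCurvatures g p, 0 ≤ k) : IsFlat g := by
  refine isFlat_of_forall_sectionalCurvatures_eq_zero fun p k hk => ?_
  obtain ⟨k₁, h₁, k₂, h₂, sum⟩ := exists_mem_sectionalCurvatures_add_eq_neg hE hRic hk
  linarith [h p k hk, h p k₁ h₁, h p k₂ h₂]

theorem mul_neg_le_Kmax_of_forall_le (hE : Module.finrank ℝ E = 4) (hRic : IsRicciFlat g)
    (hk : k ∈ sectionalCurvatures g q) (hmin : ∀ p, ∀ k' ∈ sectionalCurvatures g p, k ≤ k') :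
    (2 + √6) / 4 * -k ≤ Kmax g q := by
  have hmax (k') (hk' : k' ∈ sectionalCurvatures g q) : k' ≤ Kmax g q :=
    le_csSup (bddAbove_sectionalCurvatures g q) hk'
  have quadratic := three_mul_sq_le_of_forall_le hE hRic hk hmin hmax
  obtain ⟨k₁, h₁, k₂, h₂, sum⟩ := exists_mem_sectionalCurvatures_add_eq_neg hE hRic hk
  have midpoint_nonneg : 0 ≤ Kmax g q + k / 2 := by linarith [hmax k₁ h₁, hmax k₂ h₂]
  have sqrt_six : √6 ^ 2 = 6 := Real.sq_sqrt (by norm_num)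
  have root : √6 / 4 * -k ≤ Kmax g q + k / 2 :=
    le_of_sq_le_sq (by nlinarith) midpoint_nonneg
  linarith

end DimFour

end Riemannian

theorem theorem1p1_general {E : Type*} [NormedAddCommGroup E] [NormedSpace ℝ E]
    [FiniteDimensional ℝ E] (hE : Module.finrank ℝ E = 4)
    {M : Type*} [TopologicalSpace M] [CompactSpace M] [ChartedSpace E M]
    [IsManifold 𝓘(ℝ, E) ∞ M] (g : Riemannian.Metric E M) (hRic : Riemannian.IsRicciFlat g)
    {c : ℝ} (hc : c < (2 + √6) / 4)
    (hK : ∀ p : M, (∀ q, Riemannian.Kmin g p ≤ Riemannian.Kmin g q) →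
      Riemannian.Kmax g p ≤ -c * Riemannian.Kmin g p) :
    Riemannian.IsFlat g := by
  rcases isEmpty_or_nonempty M with hM | hM
  · exact fun p => isEmptyElim p
  have two_le : 2 ≤ Module.finrank ℝ E := by omega
  obtain ⟨q, k, hk, hmin⟩ := Riemannian.exists_forall_le_sectionalCurvatures two_le g
  have Kmin_eq : Riemannian.Kmin g q = k := IsLeast.csInf_eq ⟨hk, hmin q⟩
  have Kmin_le (p : M) : Riemannian.Kmin g q ≤ Riemannian.Kmin g p :=
    Kmin_eq ▸ le_csInf (Riemannian.nonempty_sectionalCurvatures two_le g p) (hmin p)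
  have upper := hK q Kmin_le
  rw [Kmin_eq] at upper
  have lower := Riemannian.mul_neg_le_Kmax_of_forall_le hE hRic hk hmin
  have k_nonneg : 0 ≤ k := by
    by_contra! k_neg
    linarith [mul_lt_mul_of_pos_right hc (neg_pos.2 k_neg)]
  exact Riemannian.isFlat_of_sectionalCurvatures_nonneg hE hRic fun p k' hk' =>
    k_nonneg.trans (hmin p k' hk')

/-- A compact Ricci-flat `4`-manifold with `K_max ≤ -c K_min` at every point, where
`0 ≤ c < (2 + √6) / 4`, is flat. -/
theorem theorem1p1 {M : Type*} [TopologicalSpace M] [T2Space M] [CompactSpace M]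
    [ChartedSpace (EuclideanSpace ℝ (Fin 4)) M] [IsManifold (𝓡 4) ∞ M]
    (g : Riemannian.Metric (EuclideanSpace ℝ (Fin 4)) M)
    (hRic : Riemannian.IsRicciFlat g)
    (c : ℝ) (hc0 : 0 ≤ c) (hc : c < (2 + √6) / 4)
    (hK : ∀ p : M, Riemannian.Kmax g p ≤ -c * Riemannian.Kmin g p) :
    Riemannian.IsFlat g :=
  theorem1p1_general (by simp) g hRic hc fun p _ => hK p
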